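/- There is an absolute constant $C>0$ with the following property. Let $p$ be a prime, let $\chi$ be a multiplicative character of $\mathbb F_p^*$, let $k,\ell,m$ be pairwise distinct positive integers, let $a,b,c\in\mathbb F_p^*$, and let $\Psi(X)=aX^k+bX^\ell+cX^m$. Put $$S_\chi(\Psi)=\sum_{x\in\mathbb F_p^*}\chi(x)\,e_p(\Psi(x)),\qquad e_p(u)=\exp(2\pi i u/p),$$ $$d=\gcd(k,p-1),\quad e=\gcd(\ell,p-1),\quad f=\gcd(m,p-1),\quad g=\frac{d}{\gcd(d,f)},\quad h=\frac{e}{\gcd(e,f)}.$$ Suppose that $f\ge g\ge h$. Then $$|S_\chi(\Psi)|\le C\cdot\begin{cases}p^{7/8}f^{1/8}, & \text{if } h\ge (p\log p)^{1/2},\\ p^{15/16}(f/h)^{1/8}(\log p)^{1/16}, & \text{if } g\ge (p\log p)^{1/2}>h,\\ p\,\bigl(f/(gh)\bigr)^{1/8}(\log p)^{1/8}, & \text{if } g<(p\log p)^{1/2}.\end{cases}$$ -/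

import Mathlib

open scoped BigOperators

noncomputable section

/-- The trinomial `a X^k + b X^l + c X^m` over `𝔽_p`. -/
def trinomial {p : ℕ} (a b c : ZMod p) (k l m : ℕ) : Polynomial (ZMod p) :=
  Polynomial.C a * Polynomial.X ^ k + Polynomial.C b * Polynomial.X ^ l +
    Polynomial.C c * Polynomial.X ^ m

/-- `e_p(u) = exp(2 π i u / p)` for a residue class `u` modulo `p`. -/
def ep (p : ℕ) (u : ZMod p) : ℂ :=
  Complex.exp (2 * (Real.pi : ℂ) * Complex.I * (u.val : ℂ) / (p : ℂ))

/-- `e_p` is Mathlib's standard additive character of `ZMod p`. -/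
theorem ep_eq_stdAddChar (p : ℕ) [NeZero p] (u : ZMod p) :
    ep p u = ZMod.stdAddChar u := by
  rw [ZMod.stdAddChar_apply, ZMod.toCircle_apply, ep]

/-- The sum `S_χ(Ψ) = ∑_{x ∈ 𝔽_p^*} χ(x) e_p(Ψ(x))`. -/
def charSum (p : ℕ) [Fact p.Prime] (χ : MulChar (ZMod p) ℂ) (Ψ : Polynomial (ZMod p)) : ℂ :=
  ∑ x : (ZMod p)ˣ, χ (x : ZMod p) * ep p (Ψ.eval (x : ZMod p))

end

/-!
The cases `h ≥ (p log p)^{1/2}` and `g ≥ (p log p)^{1/2}` do not occur: `f g = lcm(d, f)` divides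
`p - 1`, so `g ≤ f` gives `g ^ 2 ≤ p - 1 < p log p` (`sq_le_of_lcm`, `sub_one_lt_mul_log`). What has to
be proved is the bound `p (f / (g h))^{1/8} (log p)^{1/8}` for `h ≤ g < p^{1/2}`.

The substitutions `x ↦ x y z` with `y ^ k = 1`, `z ^ l = 1` turn the sum into an average of trilinear
sums in which `y` and `z` interact only through `e_p(c x ^ m y ^ m z ^ m)`, all other factors being
bounded weights. Two applications of Cauchy's inequality and Hölder's inequality in `x` remove the
weights (`norm_charSum_pow_four_le`). Up to multiplicities, `y ^ m` and `z ^ m` range over the groups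
`V`, `W` of roots of unity of orders `g`, `h`, and there remains the sum of the absolute values
of the monomial sums `∑_x e_p(t x ^ m)` over `t = c (v₁ - v₂)(w₁ - w₂)`. The mean square of these
monomial sums over `t` is at most `p f`, so by Cauchy's inequality everything depends on how evenly
the products `(v₁ - v₂)(w₁ - w₂)` are distributed (`sum_products_of_differences_le`).

In mean square, that distribution is governed by the multiplicative energies of `V - V` and `W - W`,
which are `O(g ^ 6 log g)` and `O(h ^ 6 log h)` (`sum_sq_diffCount_correlation_le`). The energy
of `V - V` is at most `g ^ 2` times the third moment of the number of points of `V × V` on lines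
`x - t y = c`. After division by `c`, such points are the solutions of `u ^ g = A`,
`(1 - u) ^ g = B`, and Stepanov's method (`stepanov_bound`) shows that at most `O(g ^ 2 / τ ^ 3)` pairs
`(A, B)` have `τ` or more solutions (`card_richPairs_mul_le`); summation over `τ` produces the
logarithm (`sum_linePoints_third_moment_le`).
-/

/-! ### Stepanov's method for the curves `x ^ g = A`, `(1 - x) ^ g = B` -/

open Polynomial in
/-- A nonzero polynomial of degree below `p` with at most `n` monomials cannot vanish at `1` to
order `n`. For an exponent `r` of `Q`, the operator `Q ↦ X Q' - r Q` removes exactly the monomial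
`X ^ r` and lowers the order of vanishing by at most one. -/
theorem not_X_sub_one_pow_dvd_of_card_support_le {p : ℕ} [Fact p.Prime] (n : ℕ) :
    ∀ Q : (ZMod p)[X], Q ≠ 0 → Q.support.card ≤ n → Q.natDegree < p → ¬ (X - 1) ^ n ∣ Q := by
  induction n with
  | zero =>
    intro Q hQ hs _ _
    simp_all
  | succ n ih =>
    intro Q hQ hs hd hdvd
    obtain ⟨r, hr⟩ : Q.support.Nonempty := by simpa [Finset.nonempty_iff_ne_empty] using hQ
    have hlt : ∀ j ∈ Q.support, j < p := fun j hj =>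
      (le_natDegree_of_mem_supp j hj).trans_lt hd
    set R : (ZMod p)[X] := X * derivative Q - C (r : ZMod p) * Q with hR
    have hcoeff : ∀ j, R.coeff j = ((j : ZMod p) - r) * Q.coeff j := by
      intro j
      rw [hR, coeff_sub, coeff_C_mul]
      cases j with
      | zero => simp
      | succ j => rw [coeff_X_mul, coeff_derivative]; push_cast; ring
    have hsub : R.support ⊆ Q.support.erase r := by
      intro j hj
      rw [mem_support_iff, hcoeff] at hj
      refine Finset.mem_erase.2 ⟨?_, mem_support_iff.2 (right_ne_zero_of_mul hj)⟩
      rintro rfl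
      simp at hj
    have hRdvd : (X - 1) ^ n ∣ R := by
      refine dvd_sub (Dvd.dvd.mul_left ?_ _) (Dvd.dvd.mul_left ?_ _)
      · obtain ⟨q, rfl⟩ := hdvd
        rw [derivative_mul, derivative_pow]
        refine dvd_add ?_ ?_
        · simp only [Nat.add_sub_cancel]
          exact ⟨C ((n + 1 : ℕ) : ZMod p) * derivative (X - 1) * q, by ring⟩
        · exact ⟨(X - 1) * derivative q, by ring⟩
      · exact (pow_dvd_pow _ n.le_succ).trans hdvd
    by_cases hR0 : R = 0
    · have hmono : Q.support ⊆ {r} := by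
        intro j hj
        have h1 := hcoeff j
        rw [hR0, coeff_zero] at h1
        have h2 := (mul_eq_zero.1 h1.symm).resolve_right (mem_support_iff.1 hj)
        have h3 : (j : ZMod p) = r := sub_eq_zero.1 h2
        rw [ZMod.natCast_eq_natCast_iff] at h3
        exact Finset.mem_singleton.2 (Nat.ModEq.eq_of_lt_of_lt h3 (hlt j hj) (hlt r hr))
      have h1 : Q.eval 1 = Q.coeff r := by
        rw [eval_eq_sum, sum_def, Finset.sum_subset hmono]
        · simp
        · intro x _ hx
          simp [notMem_support_iff.1 hx]
      have h2 : (X - 1 : (ZMod p)[X]) ∣ Q := (dvd_pow_self _ n.succ_ne_zero).trans hdvd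
      have h3 : Q.eval 1 = 0 := by
        obtain ⟨q, rfl⟩ := h2
        simp
      exact mem_support_iff.1 hr (h1 ▸ h3)
    · refine ih R hR0 ?_ ?_ hRdvd
      · have := Finset.card_le_card hsub
        rw [Finset.card_erase_of_mem hr] at this
        omega
      · exact hlt _ (Finset.mem_of_mem_erase (hsub (natDegree_mem_support_of_nonzero hR0)))

open Polynomial in
/-- The polynomial of Stepanov's method: a linear combination of the products
`X ^ a (X ^ g) ^ b ((1 - X) ^ g) ^ c`. -/
noncomputable def stepanovPoly {p : ℕ} (g N B : ℕ) (lam : Fin N × Fin B × Fin B → ZMod p) :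
    (ZMod p)[X] :=
  ∑ i, C (lam i) * (X ^ ((i.1 : ℕ) + g * i.2.1) * (1 - X) ^ (g * (i.2.2 : ℕ)))

open Polynomial in
/-- Sums `∑_c (1 - X) ^ (g c) Q_c` vanish only trivially when each `Q_c` has few monomials: otherwise
the first nonzero `Q_c` would be divisible by `(1 - X) ^ g`. -/
theorem eq_zero_of_sum_one_sub_X_pow_mul_eq_zero {p : ℕ} [Fact p.Prime] (g B : ℕ)
    (Q : Fin B → (ZMod p)[X]) (hs : ∀ c, (Q c).support.card ≤ g)
    (hd : ∀ c, (Q c).natDegree < p) (h0 : ∑ c : Fin B, (1 - X) ^ (g * (c : ℕ)) * Q c = 0) :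
    ∀ c, Q c = 0 := by
  intro c
  induction c using WellFoundedLT.induction with
  | _ c ih =>
    by_contra hc
    refine not_X_sub_one_pow_dvd_of_card_support_le g (Q c) hc (hs c) (hd c) ?_
    have h1 : (1 - X : (ZMod p)[X]) ^ (g * (c : ℕ)) * (1 - X) ^ g ∣
        (1 - X) ^ (g * (c : ℕ)) * Q c := by
      rw [← Finset.add_sum_erase _ _ (Finset.mem_univ c)] at h0
      rw [eq_neg_of_add_eq_zero_left h0, dvd_neg]
      refine Finset.dvd_sum fun j hj => ?_
      rcases lt_or_gt_of_ne (Finset.ne_of_mem_erase hj) with hjc | hjc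
      · simp [ih j hjc]
      · refine Dvd.dvd.mul_right ?_ _
        rw [← pow_add]
        refine pow_dvd_pow _ ?_
        have : (c : ℕ) + 1 ≤ j := hjc
        nlinarith
    have hne : (1 - X : (ZMod p)[X]) ≠ 0 := by
      intro h
      have := congrArg (eval 0) h
      simp at this
    have h2 := (mul_dvd_mul_iff_left (pow_ne_zero _ hne)).1 h1
    have h3 : (1 - X : (ZMod p)[X]) ^ g = (-1) ^ g * (X - 1) ^ g := by
      rw [← mul_pow]; ring
    rw [h3] at h2
    exact (Dvd.intro_left _ rfl).trans h2

open Polynomial in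
/-- The products in `stepanovPoly` are linearly independent when `N B ≤ g` and `g B ≤ p`. -/
theorem stepanovPoly_ne_zero {p : ℕ} [Fact p.Prime] {g N B : ℕ} (hB : 1 ≤ B) (hNB : N * B ≤ g)
    (hgB : g * B ≤ p) {lam : Fin N × Fin B × Fin B → ZMod p} (hlam : lam ≠ 0) :
    stepanovPoly g N B lam ≠ 0 := by
  intro h0
  have hNg : N ≤ g := (Nat.le_mul_of_pos_right N hB).trans hNB
  set Q : Fin B → (ZMod p)[X] := fun c =>
    ∑ ab : Fin N × Fin B, C (lam (ab.1, ab.2, c)) * X ^ ((ab.1 : ℕ) + g * ab.2) with hQ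
  have hlt : ∀ ab : Fin N × Fin B, (ab.1 : ℕ) + g * ab.2 < g * B := by
    rintro ⟨a, b⟩
    have h1 : (a : ℕ) < g := a.2.trans_le hNg
    have h2 : (b : ℕ) + 1 ≤ B := b.2
    show (a : ℕ) + g * b < g * B
    nlinarith
  have hinj : Function.Injective fun ab : Fin N × Fin B => (ab.1 : ℕ) + g * ab.2 := by
    rintro ⟨a, b⟩ ⟨a', b'⟩ h
    have h1 : (a : ℕ) < g := a.2.trans_le hNg
    have h1' : (a' : ℕ) < g := a'.2.trans_le hNg
    simp only at h
    have h2 := congrArg (· % g) h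
    simp only [Nat.add_mul_mod_self_left, Nat.mod_eq_of_lt h1, Nat.mod_eq_of_lt h1'] at h2
    have h3 : (b : ℕ) = b' := by
      rw [h2] at h
      exact Nat.eq_of_mul_eq_mul_left (by omega) (Nat.add_left_cancel h)
    exact Prod.ext (Fin.ext h2) (Fin.ext h3)
  have hsupp : ∀ c, (Q c).support ⊆
      Finset.univ.image fun ab : Fin N × Fin B => (ab.1 : ℕ) + g * ab.2 := by
    intro c j hj
    by_contra hne
    refine mem_support_iff.1 hj ?_
    rw [hQ, finsetSum_coeff]
    refine Finset.sum_eq_zero fun ab _ => ?_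
    rw [coeff_C_mul_X_pow, if_neg]
    rintro rfl
    exact hne (Finset.mem_image_of_mem _ (Finset.mem_univ _))
  have hcard : ∀ c, (Q c).support.card ≤ g := fun c =>
    (Finset.card_le_card (hsupp c)).trans <| Finset.card_image_le.trans <| by simpa using hNB
  have hdeg : ∀ c, (Q c).natDegree < p := by
    intro c
    by_cases hc : Q c = 0
    · rw [hc, natDegree_zero]
      exact (Fact.out : p.Prime).pos
    · obtain ⟨ab, -, hab⟩ := Finset.mem_image.1 (hsupp c (natDegree_mem_support_of_nonzero hc))
      rw [← hab]
      exact (hlt ab).trans_le hgB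
  have hsum : ∑ c : Fin B, (1 - X) ^ (g * (c : ℕ)) * Q c = 0 := by
    rw [← h0, stepanovPoly, hQ]
    simp only [Fintype.sum_prod_type, Finset.mul_sum]
    rw [Finset.sum_comm]
    refine Finset.sum_congr rfl fun a _ => ?_
    rw [Finset.sum_comm]
    exact Finset.sum_congr rfl fun b _ => Finset.sum_congr rfl fun c _ => by ring
  have hzero := eq_zero_of_sum_one_sub_X_pow_mul_eq_zero g B Q hcard hdeg hsum
  refine hlam (funext fun ⟨a, b, c⟩ => ?_)
  have h1 := congrArg (fun P : (ZMod p)[X] => P.coeff ((a : ℕ) + g * b)) (hzero c)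
  simp only [hQ, finsetSum_coeff, coeff_C_mul_X_pow, coeff_zero] at h1
  rw [Finset.sum_eq_single (a, b)] at h1
  · simpa using h1
  · intro ab _ hne
    rw [if_neg]
    intro h
    exact hne (hinj h).symm
  · simp

open Polynomial in
theorem natDegree_stepanovPoly_le {p g N B : ℕ} (hNg : N ≤ g)
    (lam : Fin N × Fin B × Fin B → ZMod p) :
    (stepanovPoly g N B lam).natDegree ≤ 2 * g * B := by
  refine natDegree_sum_le_of_forall_le _ _ fun i _ => ?_
  refine (natDegree_C_mul_le _ _).trans (natDegree_mul_le.trans ?_)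
  have h1 : (X ^ ((i.1 : ℕ) + g * i.2.1) : (ZMod p)[X]).natDegree ≤ (i.1 : ℕ) + g * i.2.1 :=
    natDegree_X_pow_le _
  have h2 : ((1 - X) ^ (g * (i.2.2 : ℕ)) : (ZMod p)[X]).natDegree ≤ g * (i.2.2 : ℕ) := by
    refine natDegree_pow_le.trans ?_
    refine (Nat.mul_le_mul_left _ (?_ : _ ≤ 1)).trans (by simp)
    exact (natDegree_sub_le _ _).trans (by simp [natDegree_X_le])
  have h3 : (i.2.1 : ℕ) + 1 ≤ B := i.2.1.2
  have h4 : (i.2.2 : ℕ) + 1 ≤ B := i.2.2.2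
  have h5 : (i.1 : ℕ) < g := i.1.2.trans_le hNg
  nlinarith

open Polynomial in
/-- The bivariate polynomial, in the local variable `s` over `𝔽_p[X]`, that describes
`X ^ (a + g b) (1 - X) ^ (g c)` along `x ↦ x + x (1 - x) s`, up to the constant
`(x ^ g) ^ b ((1 - x) ^ g) ^ c`. -/
noncomputable def stepanovLocal {p : ℕ} (g a b c : ℕ) : (ZMod p)[X][X] :=
  C (X ^ a) * (1 + C (1 - X) * X) ^ (a + g * b) * (1 - C X * X) ^ (g * c)

open Polynomial in
theorem natDegree_coeff_mul_le {R : Type*} [CommRing R] {P Q : R[X][X]} {m n : ℕ}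
    (hP : ∀ k, (P.coeff k).natDegree ≤ m + k) (hQ : ∀ k, (Q.coeff k).natDegree ≤ n + k) (k : ℕ) :
    ((P * Q).coeff k).natDegree ≤ m + n + k := by
  rw [coeff_mul]
  refine natDegree_sum_le_of_forall_le _ _ fun ij hij => natDegree_mul_le.trans ?_
  have h1 := hP ij.1
  have h2 := hQ ij.2
  have h3 := Finset.HasAntidiagonal.mem_antidiagonal.1 hij
  omega

open Polynomial in
theorem natDegree_coeff_pow_le {R : Type*} [CommRing R] {P : R[X][X]}
    (hP : ∀ k, (P.coeff k).natDegree ≤ k) (n k : ℕ) : ((P ^ n).coeff k).natDegree ≤ k := by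
  induction n generalizing k with
  | zero =>
    rw [pow_zero, coeff_one]
    split_ifs <;> simp
  | succ n ih =>
    rw [pow_succ]
    simpa using natDegree_coeff_mul_le (m := 0) (n := 0) (by simpa using ih) (by simpa using hP) k

open Polynomial in
theorem natDegree_coeff_one_add_C_mul_X_le {R : Type*} [CommRing R] {q : R[X]}
    (hq : q.natDegree ≤ 1) (k : ℕ) : ((1 + C q * X : R[X][X]).coeff k).natDegree ≤ k := by
  rw [coeff_add, coeff_one, coeff_C_mul, coeff_X]
  rcases k with _ | _ | k
  · simp
  · simpa using hq
  · simp

open Polynomial in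
theorem natDegree_coeff_stepanovLocal_le {p : ℕ} (g a b c k : ℕ) :
    ((stepanovLocal (p := p) g a b c).coeff k).natDegree ≤ a + k := by
  have h1 : ∀ k, ((C (X ^ a) : (ZMod p)[X][X]).coeff k).natDegree ≤ a + k := by
    intro k
    rw [coeff_C]
    split_ifs
    · exact (natDegree_X_pow_le a).trans (by omega)
    · simp
  have h2 : ∀ k, (((1 + C (1 - X) * X) ^ (a + g * b) : (ZMod p)[X][X]).coeff k).natDegree
      ≤ 0 + k := fun k =>
    (natDegree_coeff_pow_le (natDegree_coeff_one_add_C_mul_X_le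
      ((natDegree_sub_le _ _).trans (by simp [natDegree_X_le]))) (a + g * b) k).trans
      (Nat.zero_add k).ge
  have h3 : ∀ k, (((1 - C X * X) ^ (g * c) : (ZMod p)[X][X]).coeff k).natDegree
      ≤ 0 + k := fun k => by
    have h4 : (1 - C X * X : (ZMod p)[X][X]) = 1 + C (-X) * X := by rw [C_neg]; ring
    rw [h4]
    exact (natDegree_coeff_pow_le (natDegree_coeff_one_add_C_mul_X_le
      ((natDegree_neg _).trans_le natDegree_X_le)) (g * c) k).trans (Nat.zero_add k).ge
  exact natDegree_coeff_mul_le (natDegree_coeff_mul_le h1 h2) h3 k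

open Polynomial in
theorem comp_eq_map_stepanovLocal {p : ℕ} (g a b c : ℕ) (x : ZMod p) :
    (X ^ (a + g * b) * (1 - X) ^ (g * c) : (ZMod p)[X]).comp (C x + C (x * (1 - x)) * X) =
      C ((x ^ g) ^ b * ((1 - x) ^ g) ^ c) *
        (stepanovLocal g a b c).map (evalRingHom x) := by
  have h1 : (C x + C (x * (1 - x)) * X : (ZMod p)[X]) = C x * (1 + C (1 - x) * X) := by
    rw [C_mul]; ring
  have h2 : (1 - (C x + C (x * (1 - x)) * X) : (ZMod p)[X]) = C (1 - x) * (1 - C x * X) := by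
    simp only [C_mul, C_sub, C_1]; ring
  simp only [mul_comp, pow_comp, X_comp, sub_comp, one_comp, h2]
  rw [h1]
  simp only [stepanovLocal, Polynomial.map_mul, Polynomial.map_pow, Polynomial.map_add,
    Polynomial.map_sub, Polynomial.map_one, map_X, map_C, coe_evalRingHom, eval_X,
    eval_sub, eval_one, mul_pow, C_mul, C_pow, ← pow_mul, pow_add]
  ring

open Polynomial in
/-- Divisibility of `Ψ` by `(X - x) ^ N`, tested in the rescaled local variable `s`. -/
theorem X_sub_C_pow_dvd_of_comp {K : Type*} [Field K] {P : K[X]} {x w : K} (hw : w ≠ 0) {N : ℕ}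
    (h : X ^ N ∣ P.comp (C x + C w * X)) : (X - C x) ^ N ∣ P := by
  have h1 := map_dvd (compRingHom (C w⁻¹ * (X - C x))) h
  simp only [coe_compRingHom_apply, comp_assoc, add_comp, mul_comp, C_comp, X_comp,
    pow_comp, mul_pow, ← mul_assoc, ← C_mul, mul_inv_cancel₀ hw, C_1, one_mul] at h1
  rw [add_sub_cancel, comp_X] at h1
  exact (Dvd.intro_left _ rfl).trans h1

open Polynomial in
/-- Stepanov's method for the curves `x ^ g = A`, `(1 - x) ^ g = B`: the points `x ≠ 0, 1` whose pair
`(x ^ g, (1 - x) ^ g)` belongs to `J` are few. A combination of `N B ^ 2` products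
`X ^ a X ^ (g b) (1 - X) ^ (g c)` can be made to vanish to order `N` at all of them. -/
theorem stepanov_bound {p : ℕ} [Fact p.Prime] {g N B : ℕ} (hN : 1 ≤ N) (hB : 1 ≤ B)
    (hNB : N * B ≤ g) (hgB : g * B ≤ p) (J : Finset (ZMod p × ZMod p))
    (hJ : 2 * N * J.card ≤ B ^ 2) :
    N * (Finset.univ.filter fun x : ZMod p =>
      x ≠ 0 ∧ x ≠ 1 ∧ (x ^ g, (1 - x) ^ g) ∈ J).card ≤ 2 * g * B := by
  have hNg : N ≤ g := (Nat.le_mul_of_pos_right N hB).trans hNB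
  set S := Finset.univ.filter fun x : ZMod p => x ≠ 0 ∧ x ≠ 1 ∧ (x ^ g, (1 - x) ^ g) ∈ J with hS
  let T : Matrix (J × Fin N × Fin (2 * N - 1)) (Fin N × Fin B × Fin B) (ZMod p) :=
    Matrix.of fun r i => r.1.1.1 ^ (i.2.1 : ℕ) * r.1.1.2 ^ (i.2.2 : ℕ) *
      ((stepanovLocal g i.1 i.2.1 i.2.2).coeff r.2.1).coeff r.2.2
  obtain ⟨lam, hker, hlam⟩ : ∃ lam, T.mulVecLin lam = 0 ∧ lam ≠ 0 := by
    have h1 : T.mulVecLin.ker ≠ ⊥ := by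
      refine LinearMap.ker_ne_bot_of_finrank_lt ?_
      simp only [Module.finrank_pi, Fintype.card_prod, Fintype.card_fin, Fintype.card_coe]
      have h2 : J.card * (2 * N - 1) < B * B := by
        obtain ⟨n, rfl⟩ : ∃ n, N = n + 1 := ⟨N - 1, by omega⟩
        have h3 : 2 * (n + 1) - 1 = 2 * n + 1 := by omega
        rw [h3]
        rcases Nat.eq_zero_or_pos J.card with h | h
        · rw [h]; nlinarith
        · nlinarith
      calc J.card * (N * (2 * N - 1)) = N * (J.card * (2 * N - 1)) := by ring
        _ < N * (B * B) := Nat.mul_lt_mul_of_pos_left h2 hN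
    obtain ⟨lam, h2, h3⟩ := (Submodule.ne_bot_iff _).1 h1
    exact ⟨lam, LinearMap.mem_ker.1 h2, h3⟩
  have hvanish : ∀ x ∈ S, (X - C x) ^ N ∣ stepanovPoly g N B lam := by
    intro x hx
    obtain ⟨-, hx0, hx1, hxJ⟩ := Finset.mem_filter.1 hx
    refine X_sub_C_pow_dvd_of_comp (mul_ne_zero hx0 (sub_ne_zero.2 hx1.symm)) ?_
    rw [X_pow_dvd_iff]
    intro k hk
    -- the `k`-th local coefficient at `x` is the value at `x` of a polynomial of degree `≤ 2 N - 2`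
    -- that depends only on the pair `(x ^ g, (1 - x) ^ g)`
    set R : (ZMod p)[X] := ∑ i : Fin N × Fin B × Fin B,
      C (lam i * ((x ^ g) ^ (i.2.1 : ℕ) * ((1 - x) ^ g) ^ (i.2.2 : ℕ))) *
        (stepanovLocal g i.1 i.2.1 i.2.2).coeff k with hR
    have hR0 : R = 0 := by
      ext q
      rw [coeff_zero]
      by_cases hq : q < 2 * N - 1
      · have h1 := congrFun hker (⟨_, hxJ⟩, ⟨k, hk⟩, ⟨q, hq⟩)
        rw [Matrix.mulVecLin_apply, Matrix.mulVec, dotProduct, Pi.zero_apply] at h1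
        rw [hR, finsetSum_coeff, ← h1]
        refine Finset.sum_congr rfl fun i _ => ?_
        rw [coeff_C_mul]
        change _ = _ * _ * _ * lam i
        ring
      · refine coeff_eq_zero_of_natDegree_lt (lt_of_le_of_lt (?_ : _ ≤ 2 * N - 2) (by omega))
        refine natDegree_sum_le_of_forall_le _ _ fun i _ => (natDegree_C_mul_le _ _).trans ?_
        refine (natDegree_coeff_stepanovLocal_le _ _ _ _ _).trans ?_
        have := i.1.2
        omega
    have h2 : ((stepanovPoly g N B lam).comp (C x + C (x * (1 - x)) * X)).coeff k = R.eval x := by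
      rw [stepanovPoly, Polynomial.sum_comp, finsetSum_coeff, hR, eval_finsetSum]
      refine Finset.sum_congr rfl fun i _ => ?_
      rw [mul_comp, C_comp, comp_eq_map_stepanovLocal, coeff_C_mul, coeff_C_mul, coeff_map,
        eval_mul, eval_C, coe_evalRingHom]
      ring
    rw [h2, hR0, eval_zero]
  have hprod : ∏ x ∈ S, (X - C x) ^ N ∣ stepanovPoly g N B lam := by
    refine Finset.prod_dvd_of_coprime ?_ hvanish
    intro x _ y _ hxy
    exact (isCoprime_X_sub_C_of_isUnit_sub (sub_ne_zero.2 hxy).isUnit).pow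
  have hdeg := natDegree_le_of_dvd hprod (stepanovPoly_ne_zero hB hNB hgB hlam)
  rw [Finset.prod_pow, natDegree_pow, natDegree_prod_of_monic _ _ fun x _ => monic_X_sub_C x]
    at hdeg
  simp only [natDegree_X_sub_C, Finset.sum_const, smul_eq_mul, mul_one] at hdeg
  exact hdeg.trans (natDegree_stepanovPoly_le hNg lam)

/-! ### Rich lines and the third moment -/

/-- The points `x ≠ 0, 1` on the curves `x ^ g = A`, `(1 - x) ^ g = B`, where `AB = (A, B)`. -/
def powerFibre {p : ℕ} [Fact p.Prime] (g : ℕ) (AB : ZMod p × ZMod p) : Finset (ZMod p) :=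
  Finset.univ.filter fun x => x ≠ 0 ∧ x ≠ 1 ∧ x ^ g = AB.1 ∧ (1 - x) ^ g = AB.2

theorem card_pow_eq_le {p : ℕ} [Fact p.Prime] {g : ℕ} (hg : 1 ≤ g) (A : ZMod p) :
    (Finset.univ.filter fun x : ZMod p => x ^ g = A).card ≤ g := by
  have h : (Finset.univ.filter fun x : ZMod p => x ^ g = A) ⊆
      (Polynomial.nthRoots g A).toFinset := by
    intro x hx
    rw [Multiset.mem_toFinset, Polynomial.mem_nthRoots hg]
    exact (Finset.mem_filter.1 hx).2
  exact (Finset.card_le_card h).trans ((Multiset.toFinset_card_le _).trans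
    (Polynomial.card_nthRoots g A))

theorem card_powerFibre_le {p : ℕ} [Fact p.Prime] {g : ℕ} (hg : 1 ≤ g) (AB : ZMod p × ZMod p) :
    (powerFibre g AB).card ≤ g :=
  (Finset.card_le_card fun _ hx => Finset.mem_filter.2
    ⟨Finset.mem_univ _, (Finset.mem_filter.1 hx).2.2.2.1⟩).trans (card_pow_eq_le hg AB.1)

/-- The pairs `(A, B)` whose fibre has at least `τ` points. -/
def richPairs {p : ℕ} [Fact p.Prime] (g τ : ℕ) : Finset (ZMod p × ZMod p) :=
  Finset.univ.filter fun AB => τ ≤ (powerFibre g AB).card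

theorem mul_card_mul_le_of_subset_richPairs {p : ℕ} [Fact p.Prime] {g N B τ : ℕ} (hN : 1 ≤ N)
    (hB : 1 ≤ B) (hNB : N * B ≤ g) (hgB : g * B ≤ p) {J : Finset (ZMod p × ZMod p)}
    (hJ : 2 * N * J.card ≤ B ^ 2) (hsub : J ⊆ richPairs g τ) :
    N * (J.card * τ) ≤ 2 * g * B := by
  refine le_trans (Nat.mul_le_mul_left N ?_) (stepanov_bound hN hB hNB hgB J hJ)
  rw [Finset.card_eq_sum_card_fiberwise (f := fun x : ZMod p => (x ^ g, (1 - x) ^ g)) (t := J)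
    fun x hx => (Finset.mem_filter.1 hx).2.2.2]
  rw [← smul_eq_mul]
  refine Finset.card_nsmul_le_sum _ _ _ fun AB hAB => ?_
  refine (Finset.mem_filter.1 (hsub hAB)).2.trans (Finset.card_le_card fun x hx => ?_)
  obtain ⟨-, h0, h1, h2, h3⟩ := Finset.mem_filter.1 hx
  have h4 : (x ^ g, (1 - x) ^ g) = AB := Prod.ext h2 h3
  simp only [Finset.mem_filter, Finset.mem_univ, true_and]
  exact ⟨⟨h0, h1, h4 ▸ hAB⟩, h4⟩

/-- The choice of parameters in Stepanov's method for `8 N ^ 3 ≤ g ^ 2`. -/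
theorem stepanov_parameters {g N : ℕ} (hN : 1 ≤ N) (h : 8 * N ^ 3 ≤ g ^ 2) :
    1 ≤ g / N ∧ N * (g / N) ≤ g ∧ g < 2 * (N * (g / N)) ∧ 2 * N ≤ (g / N) ^ 2 := by
  have hNg : N ≤ g := by
    by_contra hlt
    push Not at hlt
    have : g ^ 2 ≤ N ^ 2 := Nat.pow_le_pow_left hlt.le 2
    have h1 : N ^ 3 = N * N ^ 2 := by ring
    have h2 : N ^ 2 ≤ N * N ^ 2 := Nat.le_mul_of_pos_left _ hN
    have h3 : 0 < N ^ 2 := by positivity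
    omega
  have hB : 1 ≤ g / N := Nat.div_pos hNg hN
  have hlt : g < 2 * (N * (g / N)) := by
    have h1 := Nat.lt_mul_div_succ g hN
    nlinarith
  refine ⟨hB, Nat.mul_div_le g N, hlt, ?_⟩
  have h1 : 4 * N ^ 2 * (2 * N) ≤ 4 * N ^ 2 * (g / N) ^ 2 := by
    have h2 : g ^ 2 ≤ (2 * (N * (g / N))) ^ 2 := Nat.pow_le_pow_left hlt.le 2
    nlinarith
  exact Nat.le_of_mul_le_mul_left h1 (by positivity)

/-- There are `O(g ^ 2 / τ ^ 3)` pairs with at least `τ` points, as the Szemerédi–Trotter bound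
predicts. -/
theorem card_richPairs_mul_le {p : ℕ} [Fact p.Prime] {g τ : ℕ} (hg : 1 ≤ g) (hgp : g ^ 2 ≤ p)
    (hτ : 64 ≤ τ) : (richPairs (p := p) g τ).card * τ ^ 3 ≤ 2 ^ 20 * g ^ 2 := by
  obtain ⟨N, hN, hNτ, hτN⟩ : ∃ N, 1 ≤ N ∧ 64 * N ≤ τ ∧ τ ≤ 128 * N :=
    ⟨τ / 64, by omega, by omega, by omega⟩
  have hgB : ∀ n, g * (g / n) ≤ p := fun n =>
    (Nat.mul_le_mul_left g (Nat.div_le_self g n)).trans ((sq g).ge.trans hgp)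
  by_cases hNg : 8 * N ^ 3 ≤ g ^ 2
  · obtain ⟨hB, hNB, hlt, hB2⟩ := stepanov_parameters hN hNg
    set B := g / N with hBdef
    set M := B ^ 2 / (2 * N) with hM
    have hM1 : 1 ≤ M := Nat.div_pos hB2 (by omega)
    have hM2 : 2 * N * M ≤ B ^ 2 := Nat.mul_div_le _ _
    have hM3 : B ^ 2 < 2 * N * (M + 1) := Nat.lt_mul_div_succ _ (by omega)
    have hcard : (richPairs (p := p) g τ).card ≤ M := by
      by_contra hlt'
      push Not at hlt'
      obtain ⟨J, hJ, hJM⟩ := Finset.exists_subset_card_eq hlt'.le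
      have h1 := mul_card_mul_le_of_subset_richPairs hN hB hNB (hgB N) (hJM ▸ hM2) hJ
      rw [hJM] at h1
      have h2 : N * (M * τ) < N * (4 * B ^ 2) := by nlinarith
      have h3 : M * τ < 4 * B ^ 2 := Nat.lt_of_mul_lt_mul_left h2
      have h4 : M * (64 * N) ≤ M * τ := Nat.mul_le_mul_left M hNτ
      have h5 : N ≤ N * M := Nat.le_mul_of_pos_right N hM1
      nlinarith
    have h1 : 2 * N ^ 3 * (richPairs (p := p) g τ).card ≤ g ^ 2 := by
      calc 2 * N ^ 3 * (richPairs (p := p) g τ).card ≤ 2 * N ^ 3 * M := Nat.mul_le_mul_left _ hcard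
        _ = N ^ 2 * (2 * N * M) := by ring
        _ ≤ N ^ 2 * B ^ 2 := Nat.mul_le_mul_left _ hM2
        _ = (N * B) ^ 2 := by ring
        _ ≤ g ^ 2 := Nat.pow_le_pow_left hNB 2
    calc (richPairs (p := p) g τ).card * τ ^ 3
        ≤ (richPairs (p := p) g τ).card * (128 * N) ^ 3 :=
          Nat.mul_le_mul_left _ (Nat.pow_le_pow_left hτN 3)
      _ = 2 ^ 20 * (2 * N ^ 3 * (richPairs (p := p) g τ).card) := by ring
      _ ≤ 2 ^ 20 * g ^ 2 := Nat.mul_le_mul_left _ h1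
  · -- beyond `τ ≍ g ^ (2/3)` no pair is left, by the extremal admissible `N` applied to a single pair
    suffices h : richPairs (p := p) g τ = ∅ by simp [h]
    by_contra hne
    obtain ⟨AB, hAB⟩ := Finset.nonempty_iff_ne_empty.2 hne
    have hτg : τ ≤ g := (Finset.mem_filter.1 hAB).2.trans (card_powerFibre_le hg AB)
    classical
    have hex : ∃ n, ¬ 8 * n ^ 3 ≤ g ^ 2 := ⟨N, hNg⟩
    obtain ⟨n, hn⟩ : ∃ n, Nat.find hex = n + 1 := by
      refine Nat.exists_eq_succ_of_ne_zero fun h0 => ?_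
      exact (Nat.find_eq_zero hex).1 h0 (by simp)
    have h1 : ¬ 8 * (n + 1) ^ 3 ≤ g ^ 2 := hn ▸ Nat.find_spec hex
    have h2 : 8 * n ^ 3 ≤ g ^ 2 := not_not.1 (Nat.find_min hex (by omega))
    have h3 : n + 1 ≤ N := hn ▸ Nat.find_min' hex hNg
    have hn1 : 1 ≤ n := by
      by_contra h0
      obtain rfl : n = 0 := by omega
      nlinarith
    obtain ⟨hB, hNB, -, hB2⟩ := stepanov_parameters hn1 h2
    have h4 := mul_card_mul_le_of_subset_richPairs (J := {AB}) hn1 hB hNB (hgB n)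
      (by simpa using hB2) (Finset.singleton_subset_iff.2 hAB)
    rw [Finset.card_singleton, one_mul] at h4
    have h5 : n ^ 2 * τ ≤ 2 * g ^ 2 := by nlinarith
    have h6 : n ^ 2 * (64 * (n + 1)) ≤ n ^ 2 * τ := Nat.mul_le_mul_left _ (by omega)
    push Not at h1
    have h7 : (n + 1) * (64 * n ^ 2) < (n + 1) * (16 * (n + 1) ^ 2) := by nlinarith
    have h8 := Nat.lt_of_mul_lt_mul_left h7
    nlinarith

/-- The points of `V × V` on the line `x - t y = c`. -/
def linePoints {p : ℕ} (V : Finset (ZMod p)) (t c : ZMod p) : Finset (ZMod p × ZMod p) :=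
  (V ×ˢ V).filter fun q => q.1 - t * q.2 = c

theorem card_linePoints_le {p : ℕ} [Fact p.Prime] {V : Finset (ZMod p)} {t c : ZMod p}
    (ht : t ≠ 0) : (linePoints V t c).card ≤ V.card := by
  refine Finset.card_le_card_of_injOn Prod.fst
    (fun q hq => (Finset.mem_product.1 (Finset.mem_filter.1 hq).1).1) ?_
  rintro ⟨x, y⟩ hq ⟨x', y'⟩ hq' (rfl : x = x')
  have h1 := (Finset.mem_filter.1 hq).2
  have h2 := (Finset.mem_filter.1 hq').2
  have h3 : t * y = t * y' := by linear_combination h2 - h1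
  exact Prod.ext rfl (mul_left_cancel₀ ht h3)

theorem sum_card_linePoints {p : ℕ} [Fact p.Prime] (V : Finset (ZMod p)) (t : ZMod p) :
    ∑ c, (linePoints V t c).card = V.card ^ 2 := by
  rw [sq, ← Finset.card_product]
  exact (Finset.card_eq_sum_card_fiberwise fun _ _ => Finset.mem_univ _).symm

/-- Dividing by `c` turns the points of `V × V` on `x - t y = c` into points of a power fibre. -/
theorem card_linePoints_le_card_powerFibre {p : ℕ} [Fact p.Prime] {g : ℕ} (hg : 1 ≤ g)
    {V : Finset (ZMod p)} (hV : ∀ v ∈ V, v ^ g = 1) {t c : ZMod p} (ht : t ≠ 0) (hc : c ≠ 0) :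
    (linePoints V t c).card ≤ (powerFibre g (c⁻¹ ^ g, (-t * c⁻¹) ^ g)).card := by
  have hV0 : ∀ v ∈ V, v ≠ 0 := by
    rintro v hv rfl
    have := hV 0 hv
    rw [zero_pow (by omega)] at this
    exact zero_ne_one this
  refine Finset.card_le_card_of_injOn (fun q => q.1 * c⁻¹) ?_ ?_
  · rintro ⟨x, y⟩ hq
    obtain ⟨hq1, hq2⟩ := Finset.mem_filter.1 hq
    obtain ⟨hx, hy⟩ := Finset.mem_product.1 hq1
    simp only at hq2 hx hy
    have h1 : 1 - x * c⁻¹ = -t * c⁻¹ * y := by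
      field_simp
      linear_combination -hq2
    refine Finset.mem_filter.2 ⟨Finset.mem_univ _, ?_, ?_, ?_, ?_⟩
    · exact mul_ne_zero (hV0 x hx) (inv_ne_zero hc)
    · intro h2
      rw [show x * c⁻¹ = 1 from h2, sub_self] at h1
      exact mul_ne_zero (mul_ne_zero (neg_ne_zero.2 ht) (inv_ne_zero hc)) (hV0 y hy) h1.symm
    · simp only [mul_pow, hV x hx, one_mul]
    · simp only [h1]
      rw [mul_pow, hV y hy, mul_one]
  · rintro ⟨x, y⟩ hq ⟨x', y'⟩ hq' h
    have hx : x = x' := mul_right_cancel₀ (inv_ne_zero hc) h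
    have h1 := (Finset.mem_filter.1 hq).2
    have h2 := (Finset.mem_filter.1 hq').2
    simp only at h1 h2
    have h3 : t * y = t * y' := by rw [hx] at h1; linear_combination h2 - h1
    exact Prod.ext hx (mul_left_cancel₀ ht h3)

/-- The parameters `(t, c)`, `c ≠ 0`, of the lines with at least `τ` points of `V × V`. -/
def richLines {p : ℕ} [Fact p.Prime] (V : Finset (ZMod p)) (τ : ℕ) :
    Finset ((ZMod p)ˣ × ZMod p) :=
  Finset.univ.filter fun tc => tc.2 ≠ 0 ∧ τ ≤ (linePoints V tc.1 tc.2).card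

theorem card_richLines_le {p : ℕ} [Fact p.Prime] {g : ℕ} (hg : 1 ≤ g)
    {V : Finset (ZMod p)} (hV : ∀ v ∈ V, v ^ g = 1) (τ : ℕ) :
    (richLines V τ).card ≤ g ^ 2 * (richPairs (p := p) g τ).card := by
  refine Finset.card_le_mul_card_image_of_maps_to
    (f := fun tc : (ZMod p)ˣ × ZMod p => (tc.2⁻¹ ^ g, (-(tc.1 : ZMod p) * tc.2⁻¹) ^ g))
    (fun tc htc => ?_) _ fun AB _ => ?_
  · obtain ⟨-, hc, hτ⟩ := Finset.mem_filter.1 htc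
    exact Finset.mem_filter.2 ⟨Finset.mem_univ _,
      hτ.trans (card_linePoints_le_card_powerFibre hg hV tc.1.ne_zero hc)⟩
  · calc _ ≤ ((Finset.univ.filter fun x : ZMod p => x ^ g = AB.1) ×ˢ
          (Finset.univ.filter fun x : ZMod p => x ^ g = AB.2)).card := by
          refine Finset.card_le_card_of_injOn
            (fun tc : (ZMod p)ˣ × ZMod p => (tc.2⁻¹, -(tc.1 : ZMod p) * tc.2⁻¹)) ?_ ?_
          · intro tc htc
            have h1 := (Finset.mem_filter.1 htc).2
            simp only [Finset.coe_product, Set.mem_prod, Finset.coe_filter, Finset.mem_univ,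
              true_and, Set.mem_ofPred_eq]
            exact ⟨congrArg Prod.fst h1, congrArg Prod.snd h1⟩
          · rintro ⟨t, c⟩ htc ⟨t', c'⟩ _ h
            have hc : c ≠ 0 :=
              (Finset.mem_filter.1 (Finset.mem_filter.1 htc).1).2.1
            obtain ⟨h1, h2⟩ := Prod.mk.inj h
            simp only at h1 h2
            rw [← h1] at h2
            have h3 : (t : ZMod p) = t' := neg_injective (mul_right_cancel₀ (inv_ne_zero hc) h2)
            exact Prod.ext (Units.ext h3) (inv_injective h1)
      _ ≤ g ^ 2 := by
          rw [Finset.card_product, sq]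
          exact Nat.mul_le_mul (card_pow_eq_le hg _) (card_pow_eq_le hg _)

/-- Ordered pairs of distinct points of `V × V` on a common line of slope parameter `t`. -/
def collinearPairs {p : ℕ} [Fact p.Prime] (V : Finset (ZMod p)) (t : ZMod p) :
    Finset ((ZMod p × ZMod p) × (ZMod p × ZMod p)) :=
  ((V ×ˢ V) ×ˢ (V ×ˢ V)).filter fun q =>
    q.1 ≠ q.2 ∧ q.1.1 - t * q.1.2 = q.2.1 - t * q.2.2

theorem card_collinearPairs {p : ℕ} [Fact p.Prime] (V : Finset (ZMod p)) (t : ZMod p) :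
    (collinearPairs V t).card =
      ∑ c, (linePoints V t c).card * ((linePoints V t c).card - 1) := by
  rw [Finset.card_eq_sum_card_fiberwise (f := fun q => q.1.1 - t * q.1.2) (t := Finset.univ)
    fun _ _ => Finset.mem_univ _]
  refine Finset.sum_congr rfl fun c _ => ?_
  rw [Nat.mul_sub_one, ← Finset.offDiag_card]
  congr 1
  ext ⟨P, Q⟩
  simp only [collinearPairs, linePoints, Finset.mem_filter, Finset.mem_product,
    Finset.mem_offDiag]
  constructor
  · rintro ⟨⟨⟨h1, h2⟩, h3, h4⟩, h5⟩
    exact ⟨⟨h1, h5⟩, ⟨h2, h4 ▸ h5⟩, h3⟩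
  · rintro ⟨⟨h1, h5⟩, ⟨h2, h4⟩, h3⟩
    exact ⟨⟨⟨h1, h2⟩, h3, h5.trans h4.symm⟩, h5⟩

/-- Two distinct points lie on at most one line with a given parametrization `x - t y = c`. -/
theorem sum_card_collinearPairs_le {p : ℕ} [Fact p.Prime] (V : Finset (ZMod p)) :
    ∑ t : (ZMod p)ˣ, (collinearPairs V (t : ZMod p)).card ≤ V.card ^ 4 := by
  simp only [collinearPairs, Finset.card_filter]
  rw [Finset.sum_comm]
  have h : V.card ^ 4 = ((V ×ˢ V) ×ˢ (V ×ˢ V)).card • 1 := by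
    simp only [Finset.card_product, smul_eq_mul]; ring
  rw [h]
  refine Finset.sum_le_card_nsmul _ _ _ fun q _ => ?_
  rw [← Finset.card_filter, Finset.card_le_one]
  rintro t ht t' ht'
  obtain ⟨-, hne, h1⟩ := Finset.mem_filter.1 ht
  obtain ⟨-, -, h2⟩ := Finset.mem_filter.1 ht'
  have h3 : q.1.2 - q.2.2 ≠ 0 := by
    intro h0
    have h4 : q.1.2 = q.2.2 := sub_eq_zero.1 h0
    refine hne (Prod.ext ?_ h4)
    rw [h4] at h1
    exact sub_left_injective h1
  refine Units.ext (mul_right_cancel₀ h3 ?_)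
  linear_combination h2 - h1

theorem mul_pred_sq_le (i : ℕ) :
    i * (i - 1) ^ 2 ≤ 64 ^ 3 * (i * (i - 1)) + ∑ τ ∈ Finset.Ioc 64 i, 3 * τ ^ 2 := by
  rcases le_or_gt i 64 with hi | hi
  · refine le_add_right ?_
    calc i * (i - 1) ^ 2 = (i - 1) * (i * (i - 1)) := by ring
      _ ≤ 64 ^ 3 * (i * (i - 1)) := Nat.mul_le_mul_right _ (by omega)
  · have h1 : ∀ n, 64 ≤ n → n ^ 3 ≤ 64 ^ 3 + ∑ τ ∈ Finset.Ioc 64 n, 3 * τ ^ 2 := by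
      intro n hn
      induction n, hn using Nat.le_induction with
      | base => simp
      | succ n hn ih =>
        rw [← Finset.insert_Ioc_right_eq_Ioc_add_one (by omega), Finset.sum_insert (by simp)]
        nlinarith
    have h2 : i * (i - 1) ^ 2 ≤ i ^ 3 := by
      calc i * (i - 1) ^ 2 ≤ i * i ^ 2 :=
            Nat.mul_le_mul_left _ (Nat.pow_le_pow_left (Nat.sub_le _ _) 2)
        _ = i ^ 3 := by ring
    have h3 : 1 ≤ i * (i - 1) := Nat.mul_pos (by omega) (by omega)
    have h4 := h1 i hi.le
    omega

theorem sum_Ioc_inv_le (g : ℕ) :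
    ∑ τ ∈ Finset.Ioc 64 g, ((τ : ℝ))⁻¹ ≤ 1 + Real.log g := by
  refine le_trans ?_ (harmonic_le_one_add_log g)
  rw [harmonic_eq_sum_Icc]
  push_cast
  refine Finset.sum_le_sum_of_subset_of_nonneg (fun τ hτ => ?_) fun _ _ _ => by positivity
  rw [Finset.mem_Ioc] at hτ
  exact Finset.mem_Icc.2 ⟨by omega, hτ.2⟩

/-- The lines through the origin contribute little: each point of `V × V` lies on `x = t y` for one
value of `t` only. -/
theorem sum_card_linePoints_zero_le {p : ℕ} [Fact p.Prime] {g : ℕ} (hg : 1 ≤ g)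
    {V : Finset (ZMod p)} (hV : ∀ v ∈ V, v ^ g = 1) (hcard : V.card ≤ g) :
    ∑ t : (ZMod p)ˣ, (linePoints V (t : ZMod p) 0).card *
      ((linePoints V (t : ZMod p) 0).card - 1) ^ 2 ≤ g ^ 4 := by
  have h0 : ∀ t : (ZMod p)ˣ, (linePoints V (t : ZMod p) 0).card ≤ g := fun t =>
    (card_linePoints_le t.ne_zero).trans hcard
  calc _ ≤ ∑ t : (ZMod p)ˣ, (linePoints V (t : ZMod p) 0).card * g ^ 2 :=
        Finset.sum_le_sum fun t _ => Nat.mul_le_mul_left _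
          (Nat.pow_le_pow_left ((Nat.sub_le _ _).trans (h0 t)) 2)
    _ = (∑ t : (ZMod p)ˣ, (linePoints V (t : ZMod p) 0).card) * g ^ 2 := by
        rw [Finset.sum_mul]
    _ ≤ g ^ 2 * g ^ 2 := by
        refine Nat.mul_le_mul_right _ ?_
        simp only [linePoints, Finset.card_filter]
        rw [Finset.sum_comm]
        calc _ ≤ (V ×ˢ V).card • 1 := by
              refine Finset.sum_le_card_nsmul _ _ _ fun q hq => ?_
              rw [← Finset.card_filter, Finset.card_le_one]
              intro t ht t' ht'
              have h1 := (Finset.mem_filter.1 ht).2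
              have h2 := (Finset.mem_filter.1 ht').2
              have hy : q.2 ≠ 0 := by
                intro hy
                have := hV _ (Finset.mem_product.1 hq).2
                rw [hy, zero_pow (by omega)] at this
                exact zero_ne_one this
              refine Units.ext (mul_right_cancel₀ hy ?_)
              linear_combination h2 - h1
          _ ≤ g ^ 2 := by
              rw [Finset.card_product, smul_eq_mul, mul_one, sq]
              exact Nat.mul_le_mul hcard hcard
    _ = g ^ 4 := by ring

/-- Third moment of the number of points of `V × V` on lines. Lines with few points are controlled by
counting pairs of points, the others by `card_richPairs_mul_le`. -/
theorem sum_linePoints_third_moment_le {p : ℕ} [Fact p.Prime] {g : ℕ} (hg : 1 ≤ g)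
    (hgp : g ^ 2 ≤ p) {V : Finset (ZMod p)} (hV : ∀ v ∈ V, v ^ g = 1) :
    ((∑ t : (ZMod p)ˣ, ∑ c, (linePoints V (t : ZMod p) c).card *
      ((linePoints V (t : ZMod p) c).card - 1) ^ 2 : ℕ) : ℝ) ≤
      2 ^ 22 * (g : ℝ) ^ 4 * (1 + Real.log g) := by
  have hcard : V.card ≤ g := (Finset.card_le_card fun v hv => Finset.mem_filter.2
    ⟨Finset.mem_univ v, hV v hv⟩).trans (card_pow_eq_le hg 1)
  set i : (ZMod p)ˣ → ZMod p → ℕ := fun t c => (linePoints V (t : ZMod p) c).card with hi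
  have hig : ∀ t c, i t c ≤ g := fun t c => (card_linePoints_le t.ne_zero).trans hcard
  have hrich : ∑ t, ∑ c ∈ Finset.univ.erase 0, ∑ τ ∈ Finset.Ioc 64 (i t c), 3 * τ ^ 2 ≤
      ∑ τ ∈ Finset.Ioc 64 g, 3 * τ ^ 2 * (richLines V τ).card := by
    have h1 : ∀ τ, (richLines V τ).card =
        ∑ t, ∑ c ∈ Finset.univ.erase 0, if τ ≤ i t c then 1 else 0 := by
      intro τ
      rw [richLines, Finset.card_filter, Fintype.sum_prod_type]
      refine Finset.sum_congr rfl fun t _ => ?_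
      rw [← Finset.add_sum_erase _ _ (Finset.mem_univ (0 : ZMod p)), if_neg (by simp), zero_add]
      refine Finset.sum_congr rfl fun c hc => ?_
      simp [Finset.ne_of_mem_erase hc, hi]
    simp only [h1, Finset.mul_sum]
    rw [Finset.sum_comm (s := Finset.Ioc 64 g)]
    refine Finset.sum_le_sum fun t _ => ?_
    rw [Finset.sum_comm (s := Finset.Ioc 64 g)]
    refine Finset.sum_le_sum fun c _ => ?_
    simp only [mul_ite, mul_one, mul_zero]
    rw [← Finset.sum_filter]
    refine Finset.sum_le_sum_of_subset fun τ hτ => ?_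
    rw [Finset.mem_Ioc] at hτ
    exact Finset.mem_filter.2 ⟨Finset.mem_Ioc.2 ⟨hτ.1, hτ.2.trans (hig t c)⟩, hτ.2⟩
  have hnat : ∑ t, ∑ c, i t c * (i t c - 1) ^ 2 ≤
      g ^ 4 + (64 ^ 3 * g ^ 4 + ∑ τ ∈ Finset.Ioc 64 g, 3 * τ ^ 2 * (richLines V τ).card) := by
    have h1 : ∀ t, ∑ c, i t c * (i t c - 1) ^ 2 ≤ i t 0 * (i t 0 - 1) ^ 2 +
        (64 ^ 3 * (collinearPairs V (t : ZMod p)).card +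
          ∑ c ∈ Finset.univ.erase 0, ∑ τ ∈ Finset.Ioc 64 (i t c), 3 * τ ^ 2) := by
      intro t
      rw [← Finset.add_sum_erase _ _ (Finset.mem_univ (0 : ZMod p))]
      refine Nat.add_le_add_left ?_ _
      calc _ ≤ ∑ c ∈ Finset.univ.erase 0, (64 ^ 3 * (i t c * (i t c - 1)) +
            ∑ τ ∈ Finset.Ioc 64 (i t c), 3 * τ ^ 2) :=
            Finset.sum_le_sum fun c _ => mul_pred_sq_le (i t c)
        _ ≤ _ := by
            rw [Finset.sum_add_distrib, ← Finset.mul_sum]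
            refine Nat.add_le_add_right (Nat.mul_le_mul_left _ ?_) _
            rw [card_collinearPairs]
            exact Finset.sum_le_sum_of_subset (Finset.erase_subset _ _)
    refine (Finset.sum_le_sum fun t _ => h1 t).trans ?_
    rw [Finset.sum_add_distrib, Finset.sum_add_distrib, ← Finset.mul_sum]
    refine Nat.add_le_add (sum_card_linePoints_zero_le hg hV hcard)
      (Nat.add_le_add (Nat.mul_le_mul_left _ ?_) hrich)
    exact (sum_card_collinearPairs_le V).trans (Nat.pow_le_pow_left hcard 4)
  have hterm : ∀ τ ∈ Finset.Ioc 64 g, (3 * (τ : ℝ) ^ 2 * ((richLines V τ).card : ℝ)) ≤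
      3 * 2 ^ 20 * (g : ℝ) ^ 4 * ((τ : ℝ))⁻¹ := by
    intro τ hτ
    have hτ64 := (Finset.mem_Ioc.1 hτ).1
    have hτ0 : (0 : ℝ) < τ := by exact_mod_cast (by omega : 0 < τ)
    have h1 : (richLines V τ).card * τ ^ 3 ≤ g ^ 2 * (2 ^ 20 * g ^ 2) :=
      (Nat.mul_le_mul_right _ (card_richLines_le hg hV τ)).trans <| by
        rw [mul_assoc]
        exact Nat.mul_le_mul_left _ (card_richPairs_mul_le hg hgp hτ64.le)
    have h2 : ((richLines V τ).card : ℝ) * (τ : ℝ) ^ 3 ≤ (g : ℝ) ^ 2 * (2 ^ 20 * (g : ℝ) ^ 2) := by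
      exact_mod_cast h1
    rw [← div_eq_mul_inv, le_div_iff₀ hτ0]
    nlinarith
  have hlog : (0 : ℝ) ≤ Real.log g := Real.log_natCast_nonneg g
  have hg4 : (0 : ℝ) ≤ (g : ℝ) ^ 4 := by positivity
  calc ((∑ t, ∑ c, i t c * (i t c - 1) ^ 2 : ℕ) : ℝ)
      ≤ ((g ^ 4 + (64 ^ 3 * g ^ 4 +
          ∑ τ ∈ Finset.Ioc 64 g, 3 * τ ^ 2 * (richLines V τ).card) : ℕ) : ℝ) := by
        exact_mod_cast hnat
    _ = (64 ^ 3 + 1) * (g : ℝ) ^ 4 +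
          ∑ τ ∈ Finset.Ioc 64 g, (3 * (τ : ℝ) ^ 2 * ((richLines V τ).card : ℝ)) := by
        push_cast; ring
    _ ≤ (64 ^ 3 + 1) * (g : ℝ) ^ 4 + 3 * 2 ^ 20 * (g : ℝ) ^ 4 * (1 + Real.log g) := by
        refine add_le_add le_rfl ((Finset.sum_le_sum hterm).trans ?_)
        rw [← Finset.mul_sum]
        exact mul_le_mul_of_nonneg_left (sum_Ioc_inv_le g) (by positivity)
    _ ≤ 2 ^ 22 * (g : ℝ) ^ 4 * (1 + Real.log g) := by
        nlinarith [mul_nonneg hg4 hlog]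

/-! ### Multiplicative energy of differences of roots of unity -/

/-- The number of representations of `s` as a difference of two elements of `V`. -/
def diffCount {p : ℕ} (V : Finset (ZMod p)) (s : ZMod p) : ℕ :=
  ((V ×ˢ V).filter fun q => q.1 - q.2 = s).card

theorem sum_diffCount_mul_le {p : ℕ} [Fact p.Prime] (V : Finset (ZMod p)) (t : (ZMod p)ˣ) :
    ∑ y : (ZMod p)ˣ, diffCount V (t * y : ZMod p) * diffCount V (y : ZMod p) ≤
      (collinearPairs V (t : ZMod p)).card := by
  simp only [diffCount, ← Finset.card_product]
  rw [← Finset.card_sigma]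
  refine Finset.card_le_card_of_injOn
    (fun q => ((q.2.1.1, q.2.2.1), (q.2.1.2, q.2.2.2))) ?_ ?_
  · rintro ⟨y, ⟨v₁, v₂⟩, ⟨v₃, v₄⟩⟩ hq
    simp only [Finset.coe_sigma, Set.mem_sigma_iff, Finset.coe_product, Set.mem_prod,
      Finset.coe_filter, Set.mem_ofPred_eq, Finset.mem_product] at hq
    obtain ⟨-, ⟨⟨h1, h2⟩, h3⟩, ⟨h4, h5⟩, h6⟩ := hq
    refine Finset.mem_filter.2 ⟨?_, ?_, ?_⟩
    · simp only [Finset.mem_product]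
      exact ⟨⟨h1, h4⟩, h2, h5⟩
    · intro h7
      simp only [Prod.mk.injEq] at h7
      rw [h7.2, sub_self] at h6
      exact y.ne_zero h6.symm
    · simp only
      linear_combination h3 - t * h6
  · rintro ⟨y, ⟨v₁, v₂⟩, ⟨v₃, v₄⟩⟩ hq ⟨y', ⟨v₁', v₂'⟩, ⟨v₃', v₄'⟩⟩ hq' h
    simp only [Finset.coe_sigma, Set.mem_sigma_iff, Finset.coe_product, Set.mem_prod,
      Finset.coe_filter, Set.mem_ofPred_eq, Finset.mem_product] at hq hq'
    simp only [Prod.mk.injEq] at h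
    obtain ⟨⟨rfl, rfl⟩, rfl, rfl⟩ := h
    obtain rfl : y = y' := Units.ext (hq.2.2.2.symm.trans hq'.2.2.2)
    rfl

/-- The number of solutions of `(v₁ - v₂)(v₃ - v₄) = (v₅ - v₆)(v₇ - v₈) ≠ 0` in a set of `g`-th roots
of unity is `O(g ^ 6 log g)`. By Cauchy's inequality it is at most `g ^ 2` times the third moment
of the number of points on lines. -/
theorem sum_sq_diffCount_correlation_le {p : ℕ} [Fact p.Prime] {g : ℕ} (hg : 1 ≤ g)
    (hgp : g ^ 2 ≤ p) {V : Finset (ZMod p)} (hV : ∀ v ∈ V, v ^ g = 1) :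
    ∑ t : (ZMod p)ˣ, (∑ y : (ZMod p)ˣ,
      (diffCount V (t * y : ZMod p) : ℝ) * (diffCount V (y : ZMod p) : ℝ)) ^ 2 ≤
      2 ^ 22 * (g : ℝ) ^ 6 * (1 + Real.log g) := by
  have hcard : V.card ≤ g := (Finset.card_le_card fun v hv => Finset.mem_filter.2
    ⟨Finset.mem_univ v, hV v hv⟩).trans (card_pow_eq_le hg 1)
  have h1 : ∀ t : (ZMod p)ˣ, (∑ y : (ZMod p)ˣ,
      (diffCount V (t * y : ZMod p) : ℝ) * (diffCount V (y : ZMod p) : ℝ)) ^ 2 ≤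
      (g : ℝ) ^ 2 * ((∑ c, (linePoints V (t : ZMod p) c).card *
        ((linePoints V (t : ZMod p) c).card - 1) ^ 2 : ℕ) : ℝ) := by
    intro t
    calc _ ≤ (((collinearPairs V (t : ZMod p)).card : ℕ) : ℝ) ^ 2 := by
          refine pow_le_pow_left₀ (Finset.sum_nonneg fun _ _ => by positivity) ?_ 2
          exact_mod_cast sum_diffCount_mul_le V t
      _ ≤ ((∑ c, (linePoints V (t : ZMod p) c).card : ℕ) : ℝ) *
          ((∑ c, (linePoints V (t : ZMod p) c).card *
            ((linePoints V (t : ZMod p) c).card - 1) ^ 2 : ℕ) : ℝ) := by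
          rw [card_collinearPairs]
          simp only [Nat.cast_sum]
          refine Finset.sum_sq_le_sum_mul_sum_of_sq_le_mul _ (fun _ _ => by positivity)
            (fun _ _ => by positivity) fun c _ => ?_
          push_cast
          exact le_of_eq (by ring)
      _ ≤ _ := by
          rw [sum_card_linePoints]
          refine mul_le_mul_of_nonneg_right ?_ (Nat.cast_nonneg _)
          exact_mod_cast Nat.pow_le_pow_left hcard 2
  calc _ ≤ ∑ t : (ZMod p)ˣ, (g : ℝ) ^ 2 * ((∑ c, (linePoints V (t : ZMod p) c).card *
        ((linePoints V (t : ZMod p) c).card - 1) ^ 2 : ℕ) : ℝ) :=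
        Finset.sum_le_sum fun t _ => h1 t
    _ ≤ (g : ℝ) ^ 2 * (2 ^ 22 * (g : ℝ) ^ 4 * (1 + Real.log g)) := by
        rw [← Finset.mul_sum, ← Nat.cast_sum]
        exact mul_le_mul_of_nonneg_left (sum_linePoints_third_moment_le hg hgp hV) (by positivity)
    _ = _ := by ring

/-- The second moment of a convolution on a finite commutative group, in terms of correlations. -/
theorem sum_convolution_sq {G : Type*} [CommGroup G] [Fintype G] (α β : G → ℝ) :
    ∑ s, (∑ x, α x * β (x⁻¹ * s)) ^ 2 =
      ∑ t, (∑ x, α (t * x) * α x) * ∑ y, β (t * y) * β y := by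
  have h1 : ∀ s, (∑ x, α x * β (x⁻¹ * s)) ^ 2 =
      ∑ x', ∑ x, (α x * β (x⁻¹ * s)) * (α x' * β (x'⁻¹ * s)) := by
    intro s
    rw [sq, Finset.sum_mul_sum, Finset.sum_comm]
  have h2 : ∀ t, (∑ x, α (t * x) * α x) * ∑ y, β (t * y) * β y =
      ∑ x', ∑ y, (α (t * x') * α x') * (β (t * y) * β y) := fun t => Finset.sum_mul_sum _ _ _ _
  simp only [h1, h2]
  rw [Finset.sum_comm, Finset.sum_comm (s := Finset.univ (α := G)) (t := Finset.univ (α := G))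
    (f := fun t x' => ∑ y, (α (t * x') * α x') * (β (t * y) * β y))]
  refine Finset.sum_congr rfl fun x' _ => ?_
  rw [Finset.sum_comm]
  refine (Fintype.sum_equiv (Equiv.mulRight x') _ _ fun t => ?_).symm
  refine Fintype.sum_equiv (Equiv.mulLeft (t * x')) _ _ fun y => ?_
  simp only [Equiv.coe_mulLeft, Equiv.coe_mulRight]
  have h3 : (t * x')⁻¹ * (t * x' * y) = y := by group
  have h4 : x'⁻¹ * (t * x' * y) = t * y := by
    rw [mul_comm t x', mul_assoc x' t y, inv_mul_cancel_left]
  rw [h3, h4]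
  ring

/-- The products `(v₁ - v₂)(w₁ - w₂) ≠ 0` are well distributed in mean square, hence so is the average
over them of any function `F`. -/
theorem sum_diffCount_mul_sq_le {p : ℕ} [Fact p.Prime] {g h : ℕ} (hg : 1 ≤ g) (hgp : g ^ 2 ≤ p)
    (hh : 1 ≤ h) (hhg : h ≤ g) {V W : Finset (ZMod p)} (hV : ∀ v ∈ V, v ^ g = 1)
    (hW : ∀ w ∈ W, w ^ h = 1) (F : (ZMod p)ˣ → ℝ) :
    (∑ x : (ZMod p)ˣ, ∑ y : (ZMod p)ˣ,
      (diffCount V (x : ZMod p) : ℝ) * (diffCount W (y : ZMod p) : ℝ) * F (x * y)) ^ 2 ≤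
      2 ^ 22 * (g : ℝ) ^ 3 * (h : ℝ) ^ 3 * (1 + Real.log g) * ∑ s, F s ^ 2 := by
  set α : (ZMod p)ˣ → ℝ := fun x => (diffCount V (x : ZMod p) : ℝ) with hα
  set β : (ZMod p)ˣ → ℝ := fun y => (diffCount W (y : ZMod p) : ℝ) with hβ
  have hhr : (1 : ℝ) ≤ h := by exact_mod_cast hh
  have hlogh : 0 ≤ Real.log h := Real.log_natCast_nonneg h
  have hlog : Real.log h ≤ Real.log g := Real.log_le_log (by linarith) (by exact_mod_cast hhg)
  have h1 : ∑ x, ∑ y, α x * β y * F (x * y) = ∑ s, (∑ x, α x * β (x⁻¹ * s)) * F s := by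
    simp only [Finset.sum_mul]
    rw [Finset.sum_comm (s := Finset.univ (α := (ZMod p)ˣ)) (t := Finset.univ (α := (ZMod p)ˣ))
      (f := fun s x => α x * β (x⁻¹ * s) * F s)]
    refine Finset.sum_congr rfl fun x _ => ?_
    refine Fintype.sum_equiv (Equiv.mulLeft x) _ _ fun y => ?_
    simp
  have hα2 : ∑ t, (∑ x, α (t * x) * α x) ^ 2 ≤ 2 ^ 22 * (g : ℝ) ^ 6 * (1 + Real.log g) := by
    simpa [hα] using sum_sq_diffCount_correlation_le hg hgp hV
  have hβ2 : ∑ t, (∑ y, β (t * y) * β y) ^ 2 ≤ 2 ^ 22 * (h : ℝ) ^ 6 * (1 + Real.log g) := by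
    have h2 := sum_sq_diffCount_correlation_le hh ((Nat.pow_le_pow_left hhg 2).trans hgp) hW
    have h3 : ∑ t, (∑ y, β (t * y) * β y) ^ 2 ≤ 2 ^ 22 * (h : ℝ) ^ 6 * (1 + Real.log h) := by
      simpa [hβ] using h2
    refine h3.trans (mul_le_mul_of_nonneg_left (by linarith) (by positivity))
  have hE : ∑ s, (∑ x, α x * β (x⁻¹ * s)) ^ 2 ≤
      2 ^ 22 * (g : ℝ) ^ 3 * (h : ℝ) ^ 3 * (1 + Real.log g) := by
    rw [sum_convolution_sq]
    refine le_of_sq_le_sq ?_ (by positivity)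
    calc _ ≤ (∑ t, (∑ x, α (t * x) * α x) ^ 2) * ∑ t, (∑ y, β (t * y) * β y) ^ 2 :=
          Finset.sum_mul_sq_le_sq_mul_sq _ _ _
      _ ≤ (2 ^ 22 * (g : ℝ) ^ 6 * (1 + Real.log g)) * (2 ^ 22 * (h : ℝ) ^ 6 * (1 + Real.log g)) :=
          mul_le_mul hα2 hβ2 (Finset.sum_nonneg fun _ _ => sq_nonneg _) (by positivity)
      _ = _ := by ring
  rw [h1]
  exact (Finset.sum_mul_sq_le_sq_mul_sq _ _ _).trans
    (mul_le_mul_of_nonneg_right hE (Finset.sum_nonneg fun _ _ => sq_nonneg _))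

theorem sum_eq_zero_add_sum_units {K : Type*} [Field K] [Fintype K] [DecidableEq K]
    (H : K → ℝ) : ∑ s, H s = H 0 + ∑ u : Kˣ, H u := by
  rw [← Finset.add_sum_erase _ _ (Finset.mem_univ (0 : K))]
  congr 1
  refine (Finset.sum_bij (fun (u : Kˣ) _ => (u : K)) (fun u _ => ?_) (fun u _ v _ huv => ?_)
    (fun s hs => ?_) fun _ _ => rfl).symm
  · exact Finset.mem_erase.2 ⟨u.ne_zero, Finset.mem_univ _⟩
  · exact Units.ext huv
  · exact ⟨Units.mk0 s (Finset.ne_of_mem_erase hs), Finset.mem_univ _, rfl⟩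

theorem sum_sub_eq_sum_diffCount {p : ℕ} [Fact p.Prime] (V : Finset (ZMod p)) (H : ZMod p → ℝ) :
    ∑ v₁ ∈ V, ∑ v₂ ∈ V, H (v₁ - v₂) =
      V.card * H 0 + ∑ u : (ZMod p)ˣ, (diffCount V (u : ZMod p) : ℝ) * H u := by
  have h0 : diffCount V 0 = V.card := by
    rw [diffCount, ← Finset.diag_card V]
    refine congrArg Finset.card ?_
    ext ⟨a, b⟩
    simp only [Finset.mem_filter, Finset.mem_product, Finset.mem_diag, sub_eq_zero]
    constructor
    · rintro ⟨⟨h1, -⟩, h2⟩; exact ⟨h1, h2⟩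
    · rintro ⟨h1, rfl⟩; exact ⟨⟨h1, h1⟩, rfl⟩
  have h1 := sum_eq_zero_add_sum_units fun s => (diffCount V s : ℝ) * H s
  simp only [h0] at h1
  rw [← h1, ← Finset.sum_product']
  rw [← Finset.sum_fiberwise_of_maps_to (g := fun q : ZMod p × ZMod p => q.1 - q.2)
    (t := Finset.univ) fun _ _ => Finset.mem_univ _]
  refine Finset.sum_congr rfl fun s _ => ?_
  rw [diffCount, ← nsmul_eq_mul]
  exact Finset.sum_eq_card_nsmul fun q hq => by rw [(Finset.mem_filter.1 hq).2]

theorem sum_diffCount_units_le {p : ℕ} [Fact p.Prime] (V : Finset (ZMod p)) :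
    ∑ u : (ZMod p)ˣ, (diffCount V (u : ZMod p) : ℝ) ≤ (V.card : ℝ) ^ 2 := by
  have h := sum_sub_eq_sum_diffCount V fun _ => 1
  simp only [Finset.sum_const, nsmul_eq_mul, mul_one] at h
  have h1 : (0 : ℝ) ≤ V.card := Nat.cast_nonneg _
  nlinarith

theorem sum_products_of_differences_le {p : ℕ} [Fact p.Prime] {g h : ℕ} (hg : 1 ≤ g)
    (hgp : g ^ 2 ≤ p) (hh : 1 ≤ h) (hhg : h ≤ g) {V W : Finset (ZMod p)}
    (hV : ∀ v ∈ V, v ^ g = 1) (hW : ∀ w ∈ W, w ^ h = 1) (F : ZMod p → ℝ) (hF : ∀ s, 0 ≤ F s) :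
    ∑ v₁ ∈ V, ∑ v₂ ∈ V, ∑ w₁ ∈ W, ∑ w₂ ∈ W, F ((v₁ - v₂) * (w₁ - w₂)) ≤
      2 * (g : ℝ) ^ 2 * h * F 0 +
        √(2 ^ 22 * (g : ℝ) ^ 3 * (h : ℝ) ^ 3 * (1 + Real.log g) * ∑ s, F s ^ 2) := by
  have hVc : (V.card : ℝ) ≤ g := by
    exact_mod_cast (Finset.card_le_card fun v hv => Finset.mem_filter.2
      ⟨Finset.mem_univ v, hV v hv⟩).trans (card_pow_eq_le hg 1)
  have hWc : (W.card : ℝ) ≤ h := by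
    exact_mod_cast (Finset.card_le_card fun v hv => Finset.mem_filter.2
      ⟨Finset.mem_univ v, hW v hv⟩).trans (card_pow_eq_le hh 1)
  have hV0 : (0 : ℝ) ≤ V.card := Nat.cast_nonneg _
  have hW0 : (0 : ℝ) ≤ W.card := Nat.cast_nonneg _
  have hhg' : (h : ℝ) ≤ g := by exact_mod_cast hhg
  have hhr : (0 : ℝ) ≤ h := Nat.cast_nonneg _
  have hgr : (0 : ℝ) ≤ g := Nat.cast_nonneg _
  have hinner : ∀ x, ∑ w₁ ∈ W, ∑ w₂ ∈ W, F (x * (w₁ - w₂)) =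
      W.card * F 0 + ∑ y : (ZMod p)ˣ, (diffCount W (y : ZMod p) : ℝ) * F (x * y) := by
    intro x
    have := sum_sub_eq_sum_diffCount W fun s => F (x * s)
    simpa using this
  have houter := sum_sub_eq_sum_diffCount V fun s => ∑ w₁ ∈ W, ∑ w₂ ∈ W, F (s * (w₁ - w₂))
  rw [houter]
  have hzero : (V.card : ℝ) * ∑ w₁ ∈ W, ∑ w₂ ∈ W, F (0 * (w₁ - w₂)) =
      V.card * W.card ^ 2 * F 0 := by
    simp only [zero_mul, Finset.sum_const, nsmul_eq_mul]
    ring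
  have hsplit : ∑ u : (ZMod p)ˣ, (diffCount V (u : ZMod p) : ℝ) *
      ∑ w₁ ∈ W, ∑ w₂ ∈ W, F (u * (w₁ - w₂)) =
      (∑ u : (ZMod p)ˣ, (diffCount V (u : ZMod p) : ℝ)) * (W.card * F 0) +
      ∑ x : (ZMod p)ˣ, ∑ y : (ZMod p)ˣ, (diffCount V (x : ZMod p) : ℝ) *
        (diffCount W (y : ZMod p) : ℝ) * F ((x * y : (ZMod p)ˣ) : ZMod p) := by
    simp only [hinner, mul_add, Finset.sum_add_distrib, Finset.sum_mul, Finset.mul_sum,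
      Units.val_mul, mul_assoc]
  rw [hzero, hsplit]
  have hmain := sum_diffCount_mul_sq_le hg hgp hh hhg hV hW fun u => F u
  have hlog : (0 : ℝ) ≤ Real.log g := Real.log_natCast_nonneg g
  have hsum : ∑ u : (ZMod p)ˣ, F u ^ 2 ≤ ∑ s, F s ^ 2 := by
    rw [sum_eq_zero_add_sum_units fun s => F s ^ 2]
    exact le_add_of_nonneg_left (sq_nonneg _)
  have hsqrt := Real.le_sqrt_of_sq_le (hmain.trans (mul_le_mul_of_nonneg_left hsum
    (by positivity)))
  have h1 : (V.card : ℝ) * W.card ^ 2 ≤ (g : ℝ) ^ 2 * h := by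
    calc (V.card : ℝ) * W.card ^ 2 ≤ (g : ℝ) * (h : ℝ) ^ 2 := by gcongr
      _ = (g : ℝ) * h * h := by ring
      _ ≤ (g : ℝ) * h * g := by gcongr
      _ = _ := by ring
  have h2 : (∑ u : (ZMod p)ˣ, (diffCount V (u : ZMod p) : ℝ)) * W.card ≤ (g : ℝ) ^ 2 * h := by
    have := sum_diffCount_units_le V
    calc _ ≤ (V.card : ℝ) ^ 2 * W.card := by gcongr
      _ ≤ (g : ℝ) ^ 2 * h := by gcongr
  have h3 := mul_le_mul_of_nonneg_right h1 (hF 0)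
  have h4 := mul_le_mul_of_nonneg_right h2 (hF 0)
  linarith

/-! ### Exponential sums -/

open ZMod in
/-- The monomial sum `∑_{x ≠ 0} e_p(t x ^ m)`. -/
noncomputable def monomialSum (p : ℕ) [Fact p.Prime] (m : ℕ) (t : ZMod p) : ℂ :=
  ∑ x : (ZMod p)ˣ, stdAddChar (t * (x : ZMod p) ^ m)

open ZMod in
theorem conj_stdAddChar {p : ℕ} [Fact p.Prime] (t : ZMod p) :
    (starRingEnd ℂ) (stdAddChar t) = stdAddChar (-t) :=
  (AddChar.map_neg_eq_conj _ _).symm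

open ZMod in
theorem norm_stdAddChar {p : ℕ} [Fact p.Prime] (t : ZMod p) : ‖stdAddChar t‖ = 1 :=
  AddChar.norm_apply _ _

theorem norm_monomialSum_le {p : ℕ} [Fact p.Prime] (m : ℕ) (t : ZMod p) :
    ‖monomialSum p m t‖ ≤ p := by
  refine (norm_sum_le _ _).trans ?_
  simp only [norm_stdAddChar, Finset.sum_const, nsmul_eq_mul, mul_one, Finset.card_univ,
    ZMod.card_units_eq_totient]
  exact_mod_cast Nat.totient_le p

theorem card_units_pow_eq_one {p : ℕ} [Fact p.Prime] (n : ℕ) :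
    (Finset.univ.filter fun x : (ZMod p)ˣ => x ^ n = 1).card = Nat.gcd n (p - 1) := by
  have h := IsCyclic.card_powMonoidHom_ker (ZMod p)ˣ n
  rw [Nat.card_eq_fintype_card (α := (ZMod p)ˣ), ZMod.card_units p, Nat.gcd_comm] at h
  rw [← h, ← Fintype.card_subtype, ← Nat.card_eq_fintype_card]
  exact Nat.card_congr (Equiv.subtypeEquivRight fun x => by
    rw [MonoidHom.mem_ker, powMonoidHom_apply])

theorem card_units_pow_eq_le {p : ℕ} [Fact p.Prime] (n : ℕ) (A : (ZMod p)ˣ) :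
    (Finset.univ.filter fun x : (ZMod p)ˣ => x ^ n = A).card ≤ Nat.gcd n (p - 1) := by
  rcases (Finset.univ.filter fun x : (ZMod p)ˣ => x ^ n = A).eq_empty_or_nonempty with h | ⟨y, hy⟩
  · simp [h]
  · rw [← card_units_pow_eq_one (p := p)]
    refine Finset.card_le_card_of_injOn (fun x => x * y⁻¹) (fun x hx => ?_)
      (fun _ _ _ _ h => mul_right_cancel h)
    refine Finset.mem_filter.2 ⟨Finset.mem_univ _, ?_⟩
    rw [mul_pow, inv_pow, (Finset.mem_filter.1 hx).2, (Finset.mem_filter.1 hy).2, mul_inv_cancel]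

open ZMod in
theorem sum_norm_sq_monomialSum_le {p : ℕ} [Fact p.Prime] (m : ℕ) :
    ∑ t, ‖monomialSum p m t‖ ^ 2 ≤ (p : ℝ) ^ 2 * Nat.gcd m (p - 1) := by
  have h1 : ((∑ t, ‖monomialSum p m t‖ ^ 2 : ℝ) : ℂ) =
      ((∑ x : (ZMod p)ˣ, ∑ y : (ZMod p)ˣ, if y ^ m = x ^ m then (p : ℝ) else 0 : ℝ) : ℂ) := by
    push_cast
    have h2 : ∀ t, (‖monomialSum p m t‖ : ℂ) ^ 2 =
        ∑ x : (ZMod p)ˣ, ∑ y : (ZMod p)ˣ,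
          stdAddChar (t * ((x : ZMod p) ^ m - (y : ZMod p) ^ m)) := by
      intro t
      rw [← Complex.mul_conj', monomialSum, map_sum, Finset.sum_mul_sum]
      refine Finset.sum_congr rfl fun x _ => Finset.sum_congr rfl fun y _ => ?_
      rw [conj_stdAddChar, ← AddChar.map_add_eq_mul]
      congr 1
      ring
    simp only [h2]
    rw [Finset.sum_comm]
    refine Finset.sum_congr rfl fun x _ => ?_
    rw [Finset.sum_comm]
    refine Finset.sum_congr rfl fun y _ => ?_
    rw [AddChar.sum_mulShift _ (isPrimitive_stdAddChar p)]
    have h3 : ((x : ZMod p) ^ m - (y : ZMod p) ^ m = 0) ↔ y ^ m = x ^ m := by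
      rw [sub_eq_zero, Units.ext_iff, eq_comm]
      push_cast
      rfl
    simp only [h3, ZMod.card]
    split_ifs <;> simp
  rw [Complex.ofReal_inj.1 h1]
  have h4 : ∀ x : (ZMod p)ˣ, (∑ y : (ZMod p)ˣ, if y ^ m = x ^ m then (p : ℝ) else 0) ≤
      (Nat.gcd m (p - 1) : ℝ) * p := by
    intro x
    rw [← Finset.sum_filter, Finset.sum_const, nsmul_eq_mul]
    refine mul_le_mul_of_nonneg_right ?_ (Nat.cast_nonneg _)
    exact_mod_cast card_units_pow_eq_le m (x ^ m)
  refine (Finset.sum_le_card_nsmul _ _ _ fun x _ => h4 x).trans ?_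
  rw [Finset.card_univ, ZMod.card_units_eq_totient, nsmul_eq_mul]
  have h5 : (p.totient : ℝ) ≤ p := by exact_mod_cast Nat.totient_le p
  calc _ ≤ (p : ℝ) * ((Nat.gcd m (p - 1) : ℝ) * p) := by gcongr
    _ = _ := by ring

open ZMod in
/-- Two applications of Cauchy's inequality remove bounded weights from a bilinear sum. -/
theorem norm_bilinear_sum_pow_four_le {p : ℕ} [Fact p.Prime] {ι : Type*} (Y Z : Finset ι)
    (φ : ι → ZMod p) (θ : ZMod p) (α β : ι → ℂ) (hα : ∀ y, ‖α y‖ ≤ 1) (hβ : ∀ z, ‖β z‖ ≤ 1) :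
    ‖∑ y ∈ Y, ∑ z ∈ Z, α y * β z * stdAddChar (θ * φ y * φ z)‖ ^ 4 ≤
      (Y.card : ℝ) ^ 2 * (Z.card : ℝ) ^ 2 *
        ∑ z₁ ∈ Z, ∑ z₂ ∈ Z, ‖∑ y ∈ Y, stdAddChar (θ * φ y * (φ z₁ - φ z₂))‖ ^ 2 := by
  set T : ι → ℂ := fun y => ∑ z ∈ Z, β z * stdAddChar (θ * φ y * φ z) with hT
  set U : ι → ι → ℂ := fun z₁ z₂ => ∑ y ∈ Y, stdAddChar (θ * φ y * (φ z₁ - φ z₂)) with hU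
  have h1 : ‖∑ y ∈ Y, ∑ z ∈ Z, α y * β z * stdAddChar (θ * φ y * φ z)‖ ≤ ∑ y ∈ Y, ‖T y‖ := by
    refine (norm_sum_le _ _).trans (Finset.sum_le_sum fun y _ => ?_)
    simp only [mul_assoc (α y), ← Finset.mul_sum]
    rw [norm_mul]
    exact mul_le_of_le_one_left (norm_nonneg _) (hα y)
  have h2 : ∑ y ∈ Y, ‖T y‖ ^ 2 ≤ ∑ z₁ ∈ Z, ∑ z₂ ∈ Z, ‖U z₁ z₂‖ := by
    have h3 : ((∑ y ∈ Y, ‖T y‖ ^ 2 : ℝ) : ℂ) =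
        ∑ z₁ ∈ Z, ∑ z₂ ∈ Z, β z₁ * (starRingEnd ℂ) (β z₂) * U z₁ z₂ := by
      push_cast
      have h4 : ∀ y, (‖T y‖ : ℂ) ^ 2 = ∑ z₁ ∈ Z, ∑ z₂ ∈ Z,
          β z₁ * (starRingEnd ℂ) (β z₂) * stdAddChar (θ * φ y * (φ z₁ - φ z₂)) := by
        intro y
        rw [← Complex.mul_conj', hT, map_sum, Finset.sum_mul_sum]
        refine Finset.sum_congr rfl fun z₁ _ => Finset.sum_congr rfl fun z₂ _ => ?_
        rw [(starRingEnd ℂ).map_mul, conj_stdAddChar, mul_sub, sub_eq_add_neg, AddChar.map_add_eq_mul]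
        ring
      simp only [h4, hU, Finset.mul_sum]
      rw [Finset.sum_comm]
      refine Finset.sum_congr rfl fun z₁ _ => ?_
      rw [Finset.sum_comm]
    have h5 : ∑ y ∈ Y, ‖T y‖ ^ 2 = ‖((∑ y ∈ Y, ‖T y‖ ^ 2 : ℝ) : ℂ)‖ := by
      rw [Complex.norm_real, Real.norm_of_nonneg (Finset.sum_nonneg fun _ _ => sq_nonneg _)]
    rw [h5, h3]
    refine (norm_sum_le _ _).trans (Finset.sum_le_sum fun z₁ _ =>
      (norm_sum_le _ _).trans (Finset.sum_le_sum fun z₂ _ => ?_))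
    rw [norm_mul, norm_mul, RCLike.norm_conj]
    exact mul_le_of_le_one_left (norm_nonneg _)
      (mul_le_one₀ (hβ z₁) (norm_nonneg _) (hβ z₂))
  have h6 : (∑ z₁ ∈ Z, ∑ z₂ ∈ Z, ‖U z₁ z₂‖) ^ 2 ≤
      (Z.card : ℝ) ^ 2 * ∑ z₁ ∈ Z, ∑ z₂ ∈ Z, ‖U z₁ z₂‖ ^ 2 := by
    rw [← Finset.sum_product', ← Finset.sum_product']
    refine sq_sum_le_card_mul_sum_sq.trans (le_of_eq ?_)
    rw [Finset.card_product, sq]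
    push_cast
    rfl
  calc ‖∑ y ∈ Y, ∑ z ∈ Z, α y * β z * stdAddChar (θ * φ y * φ z)‖ ^ 4
      ≤ (∑ y ∈ Y, ‖T y‖) ^ 4 := pow_le_pow_left₀ (norm_nonneg _) h1 4
    _ = ((∑ y ∈ Y, ‖T y‖) ^ 2) ^ 2 := by ring
    _ ≤ ((Y.card : ℝ) * ∑ z₁ ∈ Z, ∑ z₂ ∈ Z, ‖U z₁ z₂‖) ^ 2 := by
        refine pow_le_pow_left₀ (sq_nonneg _) ?_ 2
        exact sq_sum_le_card_mul_sum_sq.trans (mul_le_mul_of_nonneg_left h2 (Nat.cast_nonneg _))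
    _ = (Y.card : ℝ) ^ 2 * (∑ z₁ ∈ Z, ∑ z₂ ∈ Z, ‖U z₁ z₂‖) ^ 2 := by ring
    _ ≤ (Y.card : ℝ) ^ 2 * ((Z.card : ℝ) ^ 2 * ∑ z₁ ∈ Z, ∑ z₂ ∈ Z, ‖U z₁ z₂‖ ^ 2) := by gcongr
    _ = _ := by ring

open ZMod in
/-- Summing the bilinear bound over `x` produces monomial sums at products of differences. -/
theorem sum_norm_sq_bilinear_le {p : ℕ} [Fact p.Prime] {ι : Type*} (Y Z : Finset ι)
    (φ : ι → ZMod p) (c : ZMod p) (m : ℕ) :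
    ∑ x : (ZMod p)ˣ, ∑ z₁ ∈ Z, ∑ z₂ ∈ Z,
      ‖∑ y ∈ Y, stdAddChar (c * (x : ZMod p) ^ m * φ y * (φ z₁ - φ z₂))‖ ^ 2 ≤
      ∑ y₁ ∈ Y, ∑ y₂ ∈ Y, ∑ z₁ ∈ Z, ∑ z₂ ∈ Z,
        ‖monomialSum p m (c * ((φ y₁ - φ y₂) * (φ z₁ - φ z₂)))‖ := by
  have h1 : ((∑ x : (ZMod p)ˣ, ∑ z₁ ∈ Z, ∑ z₂ ∈ Z,
      ‖∑ y ∈ Y, stdAddChar (c * (x : ZMod p) ^ m * φ y * (φ z₁ - φ z₂))‖ ^ 2 : ℝ) : ℂ) =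
      ∑ y₁ ∈ Y, ∑ y₂ ∈ Y, ∑ z₁ ∈ Z, ∑ z₂ ∈ Z,
        monomialSum p m (c * ((φ y₁ - φ y₂) * (φ z₁ - φ z₂))) := by
    push_cast
    have h2 : ∀ (x : (ZMod p)ˣ) z₁ z₂,
        (‖∑ y ∈ Y, stdAddChar (c * (x : ZMod p) ^ m * φ y * (φ z₁ - φ z₂))‖ : ℂ) ^ 2 =
        ∑ y₁ ∈ Y, ∑ y₂ ∈ Y, stdAddChar (c * ((φ y₁ - φ y₂) * (φ z₁ - φ z₂)) *
          (x : ZMod p) ^ m) := by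
      intro x z₁ z₂
      rw [← Complex.mul_conj', map_sum, Finset.sum_mul_sum]
      refine Finset.sum_congr rfl fun y₁ _ => Finset.sum_congr rfl fun y₂ _ => ?_
      rw [conj_stdAddChar, ← AddChar.map_add_eq_mul]
      congr 1
      ring
    simp only [h2, monomialSum]
    simp only [← Finset.sum_product']
    refine Finset.sum_nbij' (fun q => (q.2.2.2.1, q.2.2.2.2, q.2.1, q.2.2.1, q.1))
      (fun q => (q.2.2.2.2, q.2.2.1, q.2.2.2.1, q.1, q.2.1)) ?_ ?_ (fun _ _ => rfl)
      (fun _ _ => rfl) (fun _ _ => rfl)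
    all_goals
      simp only [Finset.mem_product, Finset.mem_univ]
      tauto
  have h5 : ∀ r : ℝ, 0 ≤ r → r = ‖(r : ℂ)‖ := fun r hr => by
    rw [Complex.norm_real, Real.norm_of_nonneg hr]
  rw [h5 (∑ x : (ZMod p)ˣ, ∑ z₁ ∈ Z, ∑ z₂ ∈ Z,
      ‖∑ y ∈ Y, stdAddChar (c * (x : ZMod p) ^ m * φ y * (φ z₁ - φ z₂))‖ ^ 2)
    (Finset.sum_nonneg fun _ _ => Finset.sum_nonneg fun _ _ => Finset.sum_nonneg fun _ _ =>
      sq_nonneg _), h1]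
  exact (norm_sum_le _ _).trans <| Finset.sum_le_sum fun _ _ => (norm_sum_le _ _).trans <|
    Finset.sum_le_sum fun _ _ => (norm_sum_le _ _).trans <| Finset.sum_le_sum fun _ _ =>
      norm_sum_le _ _

/-- The sum over `x` is averaged over the substitutions `x ↦ x y z` with `y ^ k = 1`, `z ^ l = 1`:
the variables `y` and `z` then meet only in the phase `c x ^ m y ^ m z ^ m`. -/
theorem norm_charSum_pow_four_le {p : ℕ} [Fact p.Prime] (χ : MulChar (ZMod p) ℂ) (a b c : ZMod p)
    (k l m : ℕ) (Y Z : Finset (ZMod p)ˣ) (hY : ∀ y ∈ Y, y ^ k = 1) (hZ : ∀ z ∈ Z, z ^ l = 1) :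
    ((Y.card : ℝ) * Z.card * ‖charSum p χ (trinomial a b c k l m)‖) ^ 4 ≤
      (p : ℝ) ^ 3 * ((Y.card : ℝ) ^ 2 * (Z.card : ℝ) ^ 2 *
        ∑ y₁ ∈ Y, ∑ y₂ ∈ Y, ∑ z₁ ∈ Z, ∑ z₂ ∈ Z,
          ‖monomialSum p m (c * (((y₁ : ZMod p) ^ m - (y₂ : ZMod p) ^ m) *
            ((z₁ : ZMod p) ^ m - (z₂ : ZMod p) ^ m)))‖) := by
  set S := charSum p χ (trinomial a b c k l m) with hS
  set ψ : AddChar (ZMod p) ℂ := ZMod.stdAddChar with hψ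
  set α : (ZMod p)ˣ → (ZMod p)ˣ → ℂ := fun x y =>
    χ (x : ZMod p) * χ (y : ZMod p) * ψ (b * (x : ZMod p) ^ l * (y : ZMod p) ^ l) with hα
  set β : (ZMod p)ˣ → (ZMod p)ˣ → ℂ := fun x z =>
    χ (z : ZMod p) * ψ (a * (x : ZMod p) ^ k * (z : ZMod p) ^ k) with hβ
  set R : (ZMod p)ˣ → ℂ := fun x => ∑ y ∈ Y, ∑ z ∈ Z,
    α x y * β x z * ψ (c * (x : ZMod p) ^ m * (y : ZMod p) ^ m * (z : ZMod p) ^ m) with hR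
  have hα1 : ∀ x y, ‖α x y‖ ≤ 1 := fun x y => by
    rw [hα, norm_mul, norm_mul, norm_stdAddChar, mul_one]
    exact mul_le_one₀ (DirichletCharacter.norm_le_one χ _) (norm_nonneg _)
      (DirichletCharacter.norm_le_one χ _)
  have hβ1 : ∀ x z, ‖β x z‖ ≤ 1 := fun x z => by
    rw [hβ, norm_mul, norm_stdAddChar, mul_one]
    exact DirichletCharacter.norm_le_one χ _
  have hterm : ∀ y ∈ Y, ∀ z ∈ Z, S = ∑ x : (ZMod p)ˣ, α x y * β x z *
      ψ (c * (x : ZMod p) ^ m * (y : ZMod p) ^ m * (z : ZMod p) ^ m) := by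
    intro y hy z hz
    have hy1 : (y : ZMod p) ^ k = 1 := by
      rw [← Units.val_pow_eq_pow_val, hY y hy, Units.val_one]
    have hz1 : (z : ZMod p) ^ l = 1 := by
      rw [← Units.val_pow_eq_pow_val, hZ z hz, Units.val_one]
    rw [hS, charSum]
    refine (Fintype.sum_equiv (Equiv.mulRight (y * z)) _ _ fun x => ?_).symm
    simp only [Equiv.coe_mulRight, Units.val_mul, map_mul, ep_eq_stdAddChar, trinomial,
      Polynomial.eval_add, Polynomial.eval_mul, Polynomial.eval_C, Polynomial.eval_pow,
      Polynomial.eval_X, mul_pow, hy1, hz1, mul_one, AddChar.map_add_eq_mul, hα, hβ,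
      ← mul_assoc, ← hψ]
    ring
  have hsum : (Y.card : ℂ) * Z.card * S = ∑ x, R x := by
    have h1 : ∑ y ∈ Y, ∑ z ∈ Z, S = (Y.card : ℂ) * Z.card * S := by
      simp only [Finset.sum_const, nsmul_eq_mul, mul_assoc]
    rw [← h1, hR, Finset.sum_comm]
    rw [Finset.sum_comm]
    refine (Finset.sum_congr rfl fun y hy => Finset.sum_congr rfl fun z hz => hterm y hy z hz).trans ?_
    rw [Finset.sum_comm (s := Finset.univ)]
    exact Finset.sum_congr rfl fun y _ => Finset.sum_comm
  have hnorm : (Y.card : ℝ) * Z.card * ‖S‖ ≤ ∑ x, ‖R x‖ := by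
    have h1 := congrArg norm hsum
    rw [norm_mul, norm_mul, Complex.norm_natCast, Complex.norm_natCast] at h1
    rw [h1]
    exact norm_sum_le _ _
  have hpow : (∑ x, ‖R x‖) ^ 4 ≤ (p : ℝ) ^ 3 * ∑ x, ‖R x‖ ^ 4 := by
    have h1 := pow_sum_div_card_le_sum_pow (s := (Finset.univ : Finset (ZMod p)ˣ))
      (f := fun x => ‖R x‖) (fun _ _ => norm_nonneg _) 3
    have h2 : (0 : ℝ) < ((Finset.univ : Finset (ZMod p)ˣ).card : ℝ) := by
      exact_mod_cast Finset.card_pos.2 Finset.univ_nonempty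
    rw [div_le_iff₀ (by positivity)] at h1
    refine h1.trans ?_
    rw [mul_comm]
    refine mul_le_mul_of_nonneg_right (pow_le_pow_left₀ h2.le ?_ 3)
      (Finset.sum_nonneg fun _ _ => by positivity)
    rw [Finset.card_univ, ZMod.card_units_eq_totient]
    exact_mod_cast Nat.totient_le p
  calc _ ≤ (∑ x, ‖R x‖) ^ 4 := pow_le_pow_left₀ (by positivity) hnorm 4
    _ ≤ (p : ℝ) ^ 3 * ∑ x, ‖R x‖ ^ 4 := hpow
    _ ≤ _ := by
      refine mul_le_mul_of_nonneg_left ?_ (by positivity)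
      refine (Finset.sum_le_sum fun (x : (ZMod p)ˣ) _ => norm_bilinear_sum_pow_four_le Y Z
        (fun y : (ZMod p)ˣ => (y : ZMod p) ^ m) (c * (x : ZMod p) ^ m) (α x) (β x)
        (hα1 x) (hβ1 x)).trans ?_
      rw [← Finset.mul_sum]
      exact mul_le_mul_of_nonneg_left (sum_norm_sq_bilinear_le Y Z
        (fun y : (ZMod p)ˣ => (y : ZMod p) ^ m) c m) (by positivity)

theorem sum_comp_le_of_card_fibre_le {ι κ : Type*} [DecidableEq κ] {Y : Finset ι} {V : Finset κ}
    {φ : ι → κ} {r : ℕ} (hmaps : ∀ y ∈ Y, φ y ∈ V)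
    (hr : ∀ v ∈ V, (Y.filter fun y => φ y = v).card ≤ r) (H : κ → ℝ) (hH : ∀ v, 0 ≤ H v) :
    ∑ y ∈ Y, H (φ y) ≤ r * ∑ v ∈ V, H v := by
  rw [← Finset.sum_fiberwise_of_maps_to hmaps, Finset.mul_sum]
  refine Finset.sum_le_sum fun v hv => ?_
  rw [Finset.sum_eq_card_nsmul (b := H v) fun y hy => by rw [(Finset.mem_filter.1 hy).2],
    nsmul_eq_mul]
  exact mul_le_mul_of_nonneg_right (by exact_mod_cast hr v hv) (hH v)

theorem sum_sum_comp_le_of_card_fibre_le {ι κ : Type*} [DecidableEq κ] {Y : Finset ι}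
    {V : Finset κ} {φ : ι → κ} {r : ℕ} (hmaps : ∀ y ∈ Y, φ y ∈ V)
    (hr : ∀ v ∈ V, (Y.filter fun y => φ y = v).card ≤ r) (H : κ → κ → ℝ)
    (hH : ∀ v w, 0 ≤ H v w) :
    ∑ y₁ ∈ Y, ∑ y₂ ∈ Y, H (φ y₁) (φ y₂) ≤ (r : ℝ) ^ 2 * ∑ v ∈ V, ∑ w ∈ V, H v w := by
  calc _ ≤ ∑ y₁ ∈ Y, r * ∑ w ∈ V, H (φ y₁) w := Finset.sum_le_sum fun y₁ _ =>
        sum_comp_le_of_card_fibre_le hmaps hr (H (φ y₁)) (hH _)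
    _ = r * ∑ y₁ ∈ Y, ∑ w ∈ V, H (φ y₁) w := by rw [Finset.mul_sum]
    _ ≤ r * (r * ∑ v ∈ V, ∑ w ∈ V, H v w) := by
        refine mul_le_mul_of_nonneg_left ?_ (Nat.cast_nonneg _)
        exact sum_comp_le_of_card_fibre_le hmaps hr (fun v => ∑ w ∈ V, H v w)
          fun v => Finset.sum_nonneg fun w _ => hH v w
    _ = _ := by ring

/-- On the `k`-th roots of unity in `𝔽_p`, the map `y ↦ y ^ m` takes values in the roots of unity of
order dividing `g = d / gcd(d, f)`, each at most `gcd(d, f)` times. -/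
theorem roots_pow_fibre {p : ℕ} [Fact p.Prime] (k m : ℕ) (g r : ℕ)
    (hr : r = Nat.gcd (Nat.gcd k (p - 1)) (Nat.gcd m (p - 1)))
    (hg : g = Nat.gcd k (p - 1) / r) :
    (∀ y ∈ Finset.univ.filter fun y : (ZMod p)ˣ => y ^ k = 1,
      (y : ZMod p) ^ m ∈ Finset.univ.filter fun v : ZMod p => v ^ g = 1) ∧
    ∀ v ∈ Finset.univ.filter fun v : ZMod p => v ^ g = 1,
      ((Finset.univ.filter fun y : (ZMod p)ˣ => y ^ k = 1).filter
        fun y : (ZMod p)ˣ => (y : ZMod p) ^ m = v).card ≤ r := by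
  have hcard : ∀ y : (ZMod p)ˣ, y ^ (p - 1) = 1 := fun y => ZMod.units_pow_card_sub_one_eq_one p y
  have hrd : r ∣ Nat.gcd k (p - 1) := hr ▸ Nat.gcd_dvd_left _ _
  have hrm : r ∣ m := hr ▸ (Nat.gcd_dvd_right _ _).trans (Nat.gcd_dvd_left _ _)
  constructor
  · intro y hy
    have hyk := (Finset.mem_filter.1 hy).2
    refine Finset.mem_filter.2 ⟨Finset.mem_univ _, ?_⟩
    have h1 : y ^ Nat.gcd k (p - 1) = 1 := orderOf_dvd_iff_pow_eq_one.1
      (Nat.dvd_gcd (orderOf_dvd_of_pow_eq_one hyk) (orderOf_dvd_of_pow_eq_one (hcard y)))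
    obtain ⟨n, hn⟩ := hrm
    have h2 : m * g = Nat.gcd k (p - 1) * n := by
      rw [hn, hg, mul_right_comm, Nat.mul_div_cancel' hrd]
    rw [← pow_mul, h2, ← Units.val_pow_eq_pow_val, pow_mul, h1, one_pow, Units.val_one]
  · intro v _
    rcases ((Finset.univ.filter fun y : (ZMod p)ˣ => y ^ k = 1).filter
        fun y : (ZMod p)ˣ => (y : ZMod p) ^ m = v).eq_empty_or_nonempty with h | ⟨y₀, hy₀⟩
    · simp [h]
    · obtain ⟨hy₀1, hy₀v⟩ := Finset.mem_filter.1 hy₀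
      have hy₀k := (Finset.mem_filter.1 hy₀1).2
      have hrp : Nat.gcd r (p - 1) = r :=
        Nat.gcd_eq_left (hrd.trans (Nat.gcd_dvd_right _ _))
      rw [← hrp, ← card_units_pow_eq_one (p := p)]
      refine Finset.card_le_card_of_injOn (fun y => y * y₀⁻¹) (fun y hy => ?_)
        (fun _ _ _ _ h => mul_right_cancel h)
      obtain ⟨hy1, hyv⟩ := Finset.mem_filter.1 hy
      have hyk := (Finset.mem_filter.1 hy1).2
      have hm : y ^ m = y₀ ^ m := Units.ext (by push_cast; rw [hyv, hy₀v])
      refine Finset.mem_filter.2 ⟨Finset.mem_univ _, orderOf_dvd_iff_pow_eq_one.1 ?_⟩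
      rw [hr]
      have h1 : orderOf (y * y₀⁻¹) ∣ k := orderOf_dvd_of_pow_eq_one (by
        rw [mul_pow, inv_pow, hyk, hy₀k, inv_one, one_mul])
      have h2 : orderOf (y * y₀⁻¹) ∣ m := orderOf_dvd_of_pow_eq_one (by
        rw [mul_pow, inv_pow, hm, mul_inv_cancel])
      have h3 : orderOf (y * y₀⁻¹) ∣ p - 1 := orderOf_dvd_of_pow_eq_one (hcard _)
      exact Nat.dvd_gcd (Nat.dvd_gcd h1 h3) (Nat.dvd_gcd h2 h3)

/-! ### The bound for trinomial sums -/

/-- For `g = d / gcd(d, f)`, the product `f g = lcm(d, f)` divides `n`, so `g ≤ f` forces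
`g ^ 2 ≤ n`. -/
theorem sq_le_of_lcm {n d f : ℕ} (hn : 0 < n) (hd : d ∣ n) (hf : f ∣ n)
    (h : d / Nat.gcd d f ≤ f) : (d / Nat.gcd d f) ^ 2 ≤ n := by
  have h1 : Nat.lcm d f = d / Nat.gcd d f * f := by
    rw [Nat.lcm, Nat.div_mul_right_comm (Nat.gcd_dvd_left d f)]
  have h2 : Nat.lcm d f ≤ n := Nat.le_of_dvd hn (Nat.lcm_dvd hd hf)
  rw [sq]
  exact (Nat.mul_le_mul_left _ h).trans (h1 ▸ h2)

theorem one_add_log_le {p g : ℕ} (hp : 2 ≤ p) (hg : 1 ≤ g) (hgp : g ^ 2 ≤ p) :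
    1 + Real.log g ≤ 4 * Real.log p := by
  have hp' : (2 : ℝ) ≤ p := by exact_mod_cast hp
  have hg' : (0 : ℝ) < g := by exact_mod_cast hg
  have h1 : Real.log 2 ≤ Real.log p := Real.log_le_log (by norm_num) hp'
  have h2 := Real.log_two_gt_d9
  have h3 : Real.log ((g : ℝ) ^ 2) ≤ Real.log p :=
    Real.log_le_log (by positivity) (by exact_mod_cast hgp)
  rw [Real.log_pow] at h3
  push_cast at h3
  linarith

theorem sub_one_lt_mul_log {p : ℕ} (hp : 2 ≤ p) : (p : ℝ) - 1 < p * Real.log p := by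
  have hp' : (2 : ℝ) ≤ p := by exact_mod_cast hp
  have h1 := Real.log_lt_sub_one_of_pos (x := (p : ℝ)⁻¹) (by positivity)
    (by rw [Ne, inv_eq_one]; linarith)
  rw [Real.log_inv] at h1
  have h2 : (p : ℝ) * (p : ℝ)⁻¹ = 1 := mul_inv_cancel₀ (by linarith)
  nlinarith

/-- The eighth power of the bound for the trinomial sum. -/
theorem norm_charSum_pow_eight_le {p : ℕ} [Fact p.Prime] (χ : MulChar (ZMod p) ℂ) (a b c : ZMod p)
    (k l m : ℕ) (hc : c ≠ 0) {f g h r s : ℕ}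
    (hf : f = Nat.gcd m (p - 1))
    (hr : r = Nat.gcd (Nat.gcd k (p - 1)) f) (hg : g = Nat.gcd k (p - 1) / r)
    (hs : s = Nat.gcd (Nat.gcd l (p - 1)) f) (hh : h = Nat.gcd l (p - 1) / s)
    (hgf : g ≤ f) (hhg : h ≤ g) :
    1 ≤ g ∧ 1 ≤ h ∧ g ^ 2 ≤ p - 1 ∧
    ‖charSum p χ (trinomial a b c k l m)‖ ^ 8 * ((g : ℝ) * h) ≤
      2 ^ 28 * (p : ℝ) ^ 8 * f * Real.log p := by
  have hp : 2 ≤ p := (Fact.out : p.Prime).two_le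
  set Y := Finset.univ.filter fun y : (ZMod p)ˣ => y ^ k = 1 with hY
  set Z := Finset.univ.filter fun z : (ZMod p)ˣ => z ^ l = 1 with hZ
  set V := Finset.univ.filter fun v : ZMod p => v ^ g = 1 with hV
  set W := Finset.univ.filter fun w : ZMod p => w ^ h = 1 with hW
  have hd0 : 0 < Nat.gcd k (p - 1) := Nat.gcd_pos_of_pos_right _ (by omega)
  have he0 : 0 < Nat.gcd l (p - 1) := Nat.gcd_pos_of_pos_right _ (by omega)
  have hr0 : 0 < r := hr ▸ Nat.gcd_pos_of_pos_left _ hd0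
  have hs0 : 0 < s := hs ▸ Nat.gcd_pos_of_pos_left _ he0
  have hrd : r ∣ Nat.gcd k (p - 1) := hr ▸ Nat.gcd_dvd_left _ _
  have hse : s ∣ Nat.gcd l (p - 1) := hs ▸ Nat.gcd_dvd_left _ _
  have hg1 : 1 ≤ g := hg ▸ Nat.div_pos (Nat.le_of_dvd hd0 hrd) hr0
  have hh1 : 1 ≤ h := hh ▸ Nat.div_pos (Nat.le_of_dvd he0 hse) hs0
  have hgp : g ^ 2 ≤ p - 1 := by
    rw [hg, hr]
    refine sq_le_of_lcm (by omega) (Nat.gcd_dvd_right _ _) (hf ▸ Nat.gcd_dvd_right _ _) ?_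
    rw [← hr, ← hg]
    exact hgf
  refine ⟨hg1, hh1, hgp, ?_⟩
  have hgp' : g ^ 2 ≤ p := hgp.trans (Nat.sub_le _ _)
  have hYc : (Y.card : ℝ) = g * r := by
    rw [hY, card_units_pow_eq_one, hg]
    exact_mod_cast (Nat.div_mul_cancel hrd).symm
  have hZc : (Z.card : ℝ) = h * s := by
    rw [hZ, card_units_pow_eq_one, hh]
    exact_mod_cast (Nat.div_mul_cancel hse).symm
  set A := ‖charSum p χ (trinomial a b c k l m)‖ with hA
  have hA0 : 0 ≤ A := norm_nonneg _
  set F : ZMod p → ℝ := fun u => ‖monomialSum p m (c * u)‖ with hF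
  have hF0 : ∀ u, 0 ≤ F u := fun u => norm_nonneg _
  have hp0 : (0 : ℝ) < p := by exact_mod_cast (by omega : 0 < p)
  have hgR : (1 : ℝ) ≤ g := by exact_mod_cast hg1
  have hhR : (1 : ℝ) ≤ h := by exact_mod_cast hh1
  have hrR : (0 : ℝ) < r := by exact_mod_cast hr0
  have hsR : (0 : ℝ) < s := by exact_mod_cast hs0
  have hgfR : (g : ℝ) ≤ f := by exact_mod_cast hgf
  have hF2 : ∑ u, F u ^ 2 ≤ (p : ℝ) ^ 2 * f := by
    have h1 : ∑ u, F u ^ 2 = ∑ t, ‖monomialSum p m t‖ ^ 2 :=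
      Fintype.sum_equiv (Equiv.mulLeft₀ c hc) _ _ fun u => rfl
    rw [h1, hf]
    exact sum_norm_sq_monomialSum_le m
  set Q := ∑ v₁ ∈ V, ∑ v₂ ∈ V, ∑ w₁ ∈ W, ∑ w₂ ∈ W, F ((v₁ - v₂) * (w₁ - w₂)) with hQ
  have hfibres : ∑ y₁ ∈ Y, ∑ y₂ ∈ Y, ∑ z₁ ∈ Z, ∑ z₂ ∈ Z,
      F (((y₁ : ZMod p) ^ m - (y₂ : ZMod p) ^ m) * ((z₁ : ZMod p) ^ m - (z₂ : ZMod p) ^ m)) ≤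
      (r : ℝ) ^ 2 * ((s : ℝ) ^ 2 * Q) := by
    obtain ⟨hY1, hY2⟩ := roots_pow_fibre k m g r (hf ▸ hr) hg
    obtain ⟨hZ1, hZ2⟩ := roots_pow_fibre l m h s (hf ▸ hs) hh
    refine (sum_sum_comp_le_of_card_fibre_le hY1 hY2
      (fun v₁ v₂ => ∑ z₁ ∈ Z, ∑ z₂ ∈ Z,
        F ((v₁ - v₂) * ((z₁ : ZMod p) ^ m - (z₂ : ZMod p) ^ m)))
      fun _ _ => Finset.sum_nonneg fun _ _ => Finset.sum_nonneg fun _ _ => hF0 _).trans ?_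
    refine mul_le_mul_of_nonneg_left ?_ (by positivity)
    rw [hQ, Finset.mul_sum]
    refine Finset.sum_le_sum fun v₁ _ => ?_
    rw [Finset.mul_sum]
    refine Finset.sum_le_sum fun v₂ _ => ?_
    exact sum_sum_comp_le_of_card_fibre_le hZ1 hZ2 (fun w₁ w₂ => F ((v₁ - v₂) * (w₁ - w₂)))
      fun _ _ => hF0 _
  -- the cardinalities of the fibres cancel
  have hfour : A ^ 4 * ((g : ℝ) ^ 2 * (h : ℝ) ^ 2) ≤ (p : ℝ) ^ 3 * Q := by
    have h1 := norm_charSum_pow_four_le χ a b c k l m Y Z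
      (fun y hy => (Finset.mem_filter.1 hy).2) (fun z hz => (Finset.mem_filter.1 hz).2)
    have h2 := h1.trans (mul_le_mul_of_nonneg_left (mul_le_mul_of_nonneg_left hfibres
      (by positivity)) (by positivity))
    rw [hYc, hZc] at h2
    refine le_of_mul_le_mul_left (?_ : ((g : ℝ) ^ 2 * h ^ 2 * r ^ 4 * s ^ 4) * _ ≤
      ((g : ℝ) ^ 2 * h ^ 2 * r ^ 4 * s ^ 4) * _) (by positivity)
    calc _ = ((g : ℝ) * r * (h * s) * A) ^ 4 := by ring
      _ ≤ _ := h2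
      _ = _ := by ring
  set D := (g : ℝ) ^ 3 * (h : ℝ) ^ 3 * f * Real.log p with hD
  have hlog : (1 / 2 : ℝ) ≤ Real.log p := by
    have h1 := Real.log_two_gt_d9
    have h2 : Real.log 2 ≤ Real.log p := Real.log_le_log (by norm_num) (by exact_mod_cast hp)
    linarith
  have hD0 : 0 ≤ D := by positivity
  have hQle : Q ≤ 2 ^ 14 * p * √D := by
    have h1 := sum_products_of_differences_le hg1 hgp' hh1 hhg (V := V) (W := W)
      (fun v hv => (Finset.mem_filter.1 hv).2) (fun w hw => (Finset.mem_filter.1 hw).2) F hF0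
    have h2 : F 0 ≤ p := norm_monomialSum_le _ _
    have h3 : (g : ℝ) ^ 2 * h ≤ 2 * √D := by
      have h4 : ((g : ℝ) ^ 2 * h) ^ 2 ≤ 4 * D := by
        have h5 : (g : ℝ) ≤ h * f := by nlinarith
        have h6 : (0 : ℝ) ≤ (g : ℝ) ^ 3 * (h : ℝ) ^ 2 := by positivity
        calc ((g : ℝ) ^ 2 * h) ^ 2 = (g : ℝ) ^ 3 * (h : ℝ) ^ 2 * (g * 1) := by ring
          _ ≤ (g : ℝ) ^ 3 * (h : ℝ) ^ 2 * (h * f * (4 * Real.log p)) := by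
              refine mul_le_mul_of_nonneg_left ?_ h6
              exact mul_le_mul h5 (by linarith) zero_le_one (by positivity)
          _ = 4 * D := by rw [hD]; ring
      have h7 : (2 * √D) ^ 2 = 4 * D := by rw [mul_pow, Real.sq_sqrt hD0]; ring
      exact le_of_sq_le_sq (h4.trans h7.ge) (by positivity)
    have h8 : √(2 ^ 22 * (g : ℝ) ^ 3 * (h : ℝ) ^ 3 * (1 + Real.log g) * ∑ u, F u ^ 2) ≤
        2 ^ 12 * p * √D := by
      refine Real.sqrt_le_iff.2 ⟨by positivity, ?_⟩
      have h9 := one_add_log_le hp hg1 hgp'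
      have h10 : 0 ≤ Real.log g := Real.log_natCast_nonneg g
      calc _ ≤ 2 ^ 22 * (g : ℝ) ^ 3 * (h : ℝ) ^ 3 * (4 * Real.log p) * ((p : ℝ) ^ 2 * f) := by
            gcongr
        _ = (2 ^ 12 * p) ^ 2 * D := by rw [hD]; ring
        _ = _ := by rw [mul_pow (2 ^ 12 * (p : ℝ)) (√D), Real.sq_sqrt hD0]
    have h11 : 2 * (g : ℝ) ^ 2 * h * F 0 ≤ 4 * √D * p := by
      calc 2 * (g : ℝ) ^ 2 * h * F 0 = 2 * ((g : ℝ) ^ 2 * h) * F 0 := by ring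
        _ ≤ 2 * (2 * √D) * p := by gcongr
        _ = _ := by ring
    have h12 : 0 ≤ p * √D := by positivity
    linarith
  have hfour' : A ^ 4 * ((g : ℝ) ^ 2 * (h : ℝ) ^ 2) ≤ 2 ^ 14 * (p : ℝ) ^ 4 * √D :=
    hfour.trans <| (mul_le_mul_of_nonneg_left hQle (by positivity)).trans_eq (by ring)
  have height := pow_le_pow_left₀ (by positivity) hfour' 2
  rw [mul_pow (2 ^ 14 * (p : ℝ) ^ 4), Real.sq_sqrt hD0, hD] at height
  refine le_of_mul_le_mul_left (?_ : ((g : ℝ) ^ 3 * h ^ 3) * _ ≤ ((g : ℝ) ^ 3 * h ^ 3) * _)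
    (by positivity)
  calc _ = (A ^ 4 * ((g : ℝ) ^ 2 * (h : ℝ) ^ 2)) ^ 2 := by ring
    _ ≤ _ := height
    _ = _ := by ring

theorem theorem1p5 :
    ∃ C : ℝ, 0 < C ∧
      ∀ (p : ℕ) [Fact p.Prime] (χ : MulChar (ZMod p) ℂ) (a b c : ZMod p) (k l m : ℕ),
        a ≠ 0 → b ≠ 0 → c ≠ 0 →
        0 < k → 0 < l → 0 < m → k ≠ l → k ≠ m → l ≠ m →
        ∀ d e f g h : ℕ,
          d = Nat.gcd k (p - 1) → e = Nat.gcd l (p - 1) → f = Nat.gcd m (p - 1) →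
          g = d / Nat.gcd d f → h = e / Nat.gcd e f →
          g ≤ f → h ≤ g →
          (((p : ℝ) * Real.log p) ^ (1 / 2 : ℝ) ≤ (h : ℝ) →
            ‖charSum p χ (trinomial a b c k l m)‖ ≤
              C * ((p : ℝ) ^ (7 / 8 : ℝ) * (f : ℝ) ^ (1 / 8 : ℝ))) ∧
          (((p : ℝ) * Real.log p) ^ (1 / 2 : ℝ) ≤ (g : ℝ) →
            (h : ℝ) < ((p : ℝ) * Real.log p) ^ (1 / 2 : ℝ) →
            ‖charSum p χ (trinomial a b c k l m)‖ ≤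
              C * ((p : ℝ) ^ (15 / 16 : ℝ) * ((f : ℝ) / (h : ℝ)) ^ (1 / 8 : ℝ) *
                (Real.log p) ^ (1 / 16 : ℝ))) ∧
          ((g : ℝ) < ((p : ℝ) * Real.log p) ^ (1 / 2 : ℝ) →
            ‖charSum p χ (trinomial a b c k l m)‖ ≤
              C * ((p : ℝ) * ((f : ℝ) / ((g : ℝ) * (h : ℝ))) ^ (1 / 8 : ℝ) *
                (Real.log p) ^ (1 / 8 : ℝ))) := by
  refine ⟨16, by norm_num, ?_⟩
  intro p _ χ a b c k l m _ _ hc _ _ _ _ _ _ d e f g h hd he hf hg hh hgf hhg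
  have hp : 2 ≤ p := (Fact.out : p.Prime).two_le
  obtain ⟨hg1, hh1, hgp, h8⟩ := norm_charSum_pow_eight_le χ a b c k l m hc hf rfl
    (hd ▸ hg) rfl (he ▸ hh) hgf hhg
  set A := ‖charSum p χ (trinomial a b c k l m)‖ with hA
  have hgR : (1 : ℝ) ≤ g := by exact_mod_cast hg1
  have hhR : (1 : ℝ) ≤ h := by exact_mod_cast hh1
  have hlog0 : 0 ≤ Real.log p := Real.log_natCast_nonneg p
  -- `g ^ 2 ≤ p - 1 < p log p`, so that only the last range of parameters occurs
  have hglt : (g : ℝ) < ((p : ℝ) * Real.log p) ^ (1 / 2 : ℝ) := by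
    rw [← Real.sqrt_eq_rpow]
    refine Real.lt_sqrt_of_sq_lt (lt_of_le_of_lt ?_ (sub_one_lt_mul_log hp))
    have h1 : ((g ^ 2 : ℕ) : ℝ) ≤ ((p - 1 : ℕ) : ℝ) := by exact_mod_cast hgp
    rw [Nat.cast_sub (by omega)] at h1
    push_cast at h1
    exact h1
  have hhlt : (h : ℝ) < ((p : ℝ) * Real.log p) ^ (1 / 2 : ℝ) :=
    lt_of_le_of_lt (by exact_mod_cast hhg) hglt
  refine ⟨fun h1 => absurd h1 hhlt.not_ge, fun h1 => absurd h1 hglt.not_ge, fun _ => ?_⟩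
  have hpow : ∀ x : ℝ, 0 ≤ x → (x ^ (1 / 8 : ℝ)) ^ 8 = x := fun x hx => by
    rw [← Real.rpow_natCast, ← Real.rpow_mul hx]
    norm_num
  refine (pow_le_pow_iff_left₀ (norm_nonneg _) (by positivity) (by norm_num : 8 ≠ 0)).1 ?_
  rw [mul_pow, mul_pow, mul_pow, hpow _ (by positivity), hpow _ hlog0]
  have hgh : (0 : ℝ) < (g : ℝ) * h := by positivity
  have h1 : A ^ 8 ≤ 2 ^ 28 * (p : ℝ) ^ 8 * f * Real.log p / ((g : ℝ) * h) :=
    (le_div_iff₀ hgh).2 h8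
  refine h1.trans ?_
  have h2 : (0 : ℝ) ≤ (p : ℝ) ^ 8 * (f / ((g : ℝ) * h)) * Real.log p := by positivity
  calc _ = 2 ^ 28 * ((p : ℝ) ^ 8 * (f / ((g : ℝ) * h)) * Real.log p) := by ring
    _ ≤ 16 ^ 8 * ((p : ℝ) ^ 8 * (f / ((g : ℝ) * h)) * Real.log p) :=
        mul_le_mul_of_nonneg_right (by norm_num) h2
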